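/- Let $D\subseteq\mathbb R^N$ be open, $\delta>0$, $T>0$, $f_0\in C^2(D;\mathbb R^N)$, and let $f_1\in C^2(D\times\mathbb R\times(-\delta,\delta);\mathbb R^N)$ be $T$-periodic in its second argument $t$. Consider the system $$\dot x=f_0(x)+\epsilon f_1(x,t;\epsilon).\qquad(1)$$ Assume that for $\epsilon=0$ the set $D$ is full of periodic orbits with a $C^1$ period: through each $p\in D$ there passes a periodic solution of $\dot x=f_0(x)$ in $D$, with minimal period $P(p)>0$, and $P\in C^1(D;\mathbb R)$. Let $t_0\in\mathbb R$, let $m,n\ge 1$ be integers, let $S\subseteq(-\delta,\delta)$ be a set of parameter values with $0\in S$ (for instance $S=[0,\epsilon_1)$ or $S=(-\epsilon_1,\epsilon_1)$), and for each $\epsilon\in S$ let $x(t,x_0^*(\epsilon))$ be an $nT$-periodic solution of (1) in $D$ with value $x_0^*(\epsilon)$ at $t=t_0$, such that $x_0^*:=x_0^*(0)$ satisfies the resonance condition $mP(x_0^*)=nT$ and $\epsilon\mapsto x_0^*(\epsilon)$ is differentiable at $\epsilon=0$ (within $S$). Write $x(t,x_0^*)$ for the unperturbed periodic orbit ($\epsilon=0$),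 and let $x_1(t)$ be the first-order term in $\epsilon$ of $x(t,x_0^*(\epsilon))$, i.e. the solution of $$\dot x_1=\frac{\partial f_0}{\partial x}(x(t,x_0^*))\,x_1+f_1(x(t,x_0^*),t;0),\qquad x_1(t_0)=\frac{d x_0^*}{d\epsilon}(0).$$ Put $$A(t;\epsilon)=\frac{\partial f_0}{\partial x}(x(t,x_0^*))+\epsilon\left(\frac{\partial f_1}{\partial x}(x(t,x_0^*),t;0)+\frac{\partial^2 f_0}{\partial x^2}(x(t,x_0^*))\,x_1(t)\right),\qquad \lambda_\epsilon=\frac1{nT}\int_{t_0}^{t_0+nT}\operatorname{Tr}A(t;\epsilon)\,dt.$$ Then there is $\epsilon_0>0$ such that for every $\epsilon\in S$ with $0<|\epsilon|<\epsilon_0$: if $\lambda_\epsilon>0$, then the periodic solution $x(t,x_0^*(\epsilon))$ of (1) is unstable, that is, not Lyapunov stable for $t\ge t_0$. -/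

import Mathlib

open Set

/-- `y : ℝ → ℝᴺ` is a solution, defined for all times and staying in `D`, of the differential
equation `y' = F t y`. -/
def IsSolution {N : ℕ} (D : Set (EuclideanSpace ℝ (Fin N)))
    (F : ℝ → EuclideanSpace ℝ (Fin N) → EuclideanSpace ℝ (Fin N))
    (y : ℝ → EuclideanSpace ℝ (Fin N)) : Prop :=
  ∀ t : ℝ, y t ∈ D ∧ HasDerivAt y (F t (y t)) t

/-- The open domain `D` is full of periodic orbits of the autonomous system `y' = f₀ y`:
through each `p ∈ D` there passes a periodic solution in `D`, whose minimal period is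
the positive number `P p`, and `P` is of class `C¹` on `D`. -/
def IsPeriodFunction {N : ℕ} (D : Set (EuclideanSpace ℝ (Fin N)))
    (f₀ : EuclideanSpace ℝ (Fin N) → EuclideanSpace ℝ (Fin N))
    (P : EuclideanSpace ℝ (Fin N) → ℝ) : Prop :=
  ContDiffOn ℝ 1 P D ∧
    ∀ p ∈ D, 0 < P p ∧ ∃ y : ℝ → EuclideanSpace ℝ (Fin N),
      y 0 = p ∧ IsSolution D (fun _ z => f₀ z) y ∧ Function.Periodic y (P p) ∧
        ∀ s : ℝ, 0 < s → s < P p → ¬ Function.Periodic y s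

/-- The right-hand side `f₀ x + ε f₁(x, t; ε)` of the perturbed system. -/
noncomputable def perturbedField {N : ℕ}
    (f₀ : EuclideanSpace ℝ (Fin N) → EuclideanSpace ℝ (Fin N))
    (f₁ : EuclideanSpace ℝ (Fin N) → ℝ → ℝ → EuclideanSpace ℝ (Fin N))
    (ε t : ℝ) (z : EuclideanSpace ℝ (Fin N)) : EuclideanSpace ℝ (Fin N) :=
  f₀ z + ε • f₁ z t ε

/-- Lyapunov stability of the solution `x` of `y' = F t y` in `D`, from the initial time `t₀` on:
every solution that starts at time `t₀` close enough to `x t₀` exists (in `D`) for all `t ≥ t₀`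
and stays within any prescribed distance of `x t`. -/
def IsLyapunovStable {N : ℕ} (D : Set (EuclideanSpace ℝ (Fin N)))
    (F : ℝ → EuclideanSpace ℝ (Fin N) → EuclideanSpace ℝ (Fin N)) (t₀ : ℝ)
    (x : ℝ → EuclideanSpace ℝ (Fin N)) : Prop :=
  ∀ η : ℝ, 0 < η → ∃ ρ : ℝ, 0 < ρ ∧ ∀ y₀ ∈ D, ‖y₀ - x t₀‖ < ρ →
    ∃ y : ℝ → EuclideanSpace ℝ (Fin N), y t₀ = y₀ ∧
      ∀ t : ℝ, t₀ ≤ t →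
        y t ∈ D ∧ HasDerivWithinAt y (F t (y t)) (Ici t₀) t ∧ ‖y t - x t‖ < η

/-- A solution is unstable if it is not Lyapunov stable. -/
def IsUnstable {N : ℕ} (D : Set (EuclideanSpace ℝ (Fin N)))
    (F : ℝ → EuclideanSpace ℝ (Fin N) → EuclideanSpace ℝ (Fin N)) (t₀ : ℝ)
    (x : ℝ → EuclideanSpace ℝ (Fin N)) : Prop :=
  ¬ IsLyapunovStable D F t₀ x

/-- The matrix (as a linear map)
`A(t; ε) = ∂f₀/∂x (x₀ t) + ε (∂f₁/∂x (x₀ t, t; 0) + ∂²f₀/∂x² (x₀ t) x₁ t)`. -/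
noncomputable def linearizationA {N : ℕ}
    (f₀ : EuclideanSpace ℝ (Fin N) → EuclideanSpace ℝ (Fin N))
    (f₁ : EuclideanSpace ℝ (Fin N) → ℝ → ℝ → EuclideanSpace ℝ (Fin N))
    (x₀ x₁ : ℝ → EuclideanSpace ℝ (Fin N)) (t ε : ℝ) :
    EuclideanSpace ℝ (Fin N) →L[ℝ] EuclideanSpace ℝ (Fin N) :=
  fderiv ℝ f₀ (x₀ t) +
    ε • (fderiv ℝ (fun z => f₁ z t 0) (x₀ t) + fderiv ℝ (fderiv ℝ f₀) (x₀ t) (x₁ t))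

/-- The mean trace `λ_ε = (1 / (n T)) ∫_{t₀}^{t₀ + n T} Tr A(t; ε) dt`. -/
noncomputable def meanTrace {N : ℕ}
    (f₀ : EuclideanSpace ℝ (Fin N) → EuclideanSpace ℝ (Fin N))
    (f₁ : EuclideanSpace ℝ (Fin N) → ℝ → ℝ → EuclideanSpace ℝ (Fin N))
    (x₀ x₁ : ℝ → EuclideanSpace ℝ (Fin N)) (t₀ T : ℝ) (n : ℕ) (ε : ℝ) : ℝ :=
  1 / ((n : ℝ) * T) * ∫ t in t₀..(t₀ + (n : ℝ) * T),
    LinearMap.trace ℝ (EuclideanSpace ℝ (Fin N))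
      (linearizationA f₀ f₁ x₀ x₁ t ε :
        EuclideanSpace ℝ (Fin N) →ₗ[ℝ] EuclideanSpace ℝ (Fin N))

/-! ### Gronwall estimates near a given trajectory -/

section PerturbedTrajectories

open Filter Topology Metric

/-! The argument compares volumes and needs no Floquet theory. By Liouville's formula the derivative
of the flow has determinant the exponential of the integrated divergence. If a periodic solution has
integrated divergence `I > 0` over one period and were stable, a small ball of initial values would
stay so close to it that each period contributes at least `I / 2`. After `k` periods the volume of
the ball has grown by at least `exp (k * I / 2)`, yet its image lies in a fixed ball: a
contradiction (`isUnstable_of_integral_trace_pos`).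

It remains to find the sign of the divergence integrated along the perturbed solution. The
first-order expansion of the branch (`exists_norm_fderiv_sub_linearizationA_le`) shows that it
differs by `o(ε)` from the integral of `Tr A(t; ε)`, which is affine in `ε`. An error `o(ε)` is
harmless only if the constant term vanishes, and this is where the period function enters. Let `Q =
m P`, let `p` be the resonant point and `φ` the unperturbed flow. Differentiating `φ (Q y) y = y` at
`p` shows that the flow at the fixed time `Q p` has derivative `v ↦ v - dQ(v) f₀(p)`. Its
determinant is `1 - dQ(f₀(p)) = 1`, because `Q` is constant along orbits, so the integrated
divergence of `f₀` is zero (`IsPeriodFunction.integral_trace_eq_zero`). Hence `n T λ_ε = ε c`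
exactly, and for small `ε` with `ε c > 0` the true integral is at least `ε c / 2`. -/

theorem exists_forall_norm_sub_lt_of_isCompact {H G : Type*} [NormedAddCommGroup H]
    [NormedAddCommGroup G] {W K : Set H} (hW : IsOpen W) {f : H → G}
    (hf : ContinuousOn f W) (hK : IsCompact K) (hKW : K ⊆ W) {κ : ℝ} (hκ : 0 < κ) :
    ∃ ρ > 0, ∀ p ∈ K, ∀ z, ‖z - p‖ < ρ → z ∈ W ∧ ‖f z - f p‖ < κ := by
  have h1 := hK.uniformContinuousAt_of_continuousAt f
    (fun p hp => hf.continuousAt (hW.mem_nhds (hKW hp))) (dist_mem_uniformity hκ)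
  obtain ⟨ρ₁, hρ₁, h1⟩ := Metric.mem_uniformity_dist.1 h1
  obtain ⟨ρ₂, hρ₂, h2⟩ := hK.exists_thickening_subset_open hW hKW
  refine ⟨min ρ₁ ρ₂, lt_min hρ₁ hρ₂, fun p hp z hz => ⟨h2 ?_, ?_⟩⟩
  · rw [mem_thickening_iff]
    exact ⟨p, hp, by rw [dist_eq_norm]; exact hz.trans_le (min_le_right _ _)⟩
  · have : dist p z < ρ₁ := by
      rw [dist_comm, dist_eq_norm]; exact hz.trans_le (min_le_left _ _)
    have := h1 this hp
    simpa [dist_eq_norm, norm_sub_rev] using this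

variable {H G : Type*} [NormedAddCommGroup H] [NormedSpace ℝ H]
  [NormedAddCommGroup G] [NormedSpace ℝ G]

/-- `X` is a trajectory in `W` over `[a, b]` of the time-dependent vector field `V`, with
right derivatives. -/
structure IsTrajOn (V : ℝ → H → H) (W : Set H) (a b : ℝ) (X : ℝ → H) : Prop where
  continuousOn : ContinuousOn X (Icc a b)
  mem : ∀ t ∈ Icc a b, X t ∈ W
  hasDeriv : ∀ t ∈ Ico a b, HasDerivWithinAt X (V t (X t)) (Ici t) t

theorem IsTrajOn.mono {V : ℝ → H → H} {W : Set H} {a b c : ℝ} {X : ℝ → H}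
    (h : IsTrajOn V W a b X) (hc : c ≤ b) : IsTrajOn V W a c X :=
  ⟨h.continuousOn.mono (Icc_subset_Icc_right hc), fun t ht => h.mem t ⟨ht.1, ht.2.trans hc⟩,
    fun t ht => h.hasDeriv t ⟨ht.1, ht.2.trans_le hc⟩⟩

/-- Mean value inequality on a ball where the derivative varies by less than `κ`; compactness makes
the radius uniform in `p`. -/
theorem exists_forall_norm_sub_sub_fderiv_le_of_isCompact {W K : Set H} (hW : IsOpen W) {f : H → G}
    (hf : ContDiffOn ℝ 1 f W) (hK : IsCompact K) (hKW : K ⊆ W) {κ : ℝ} (hκ : 0 < κ) :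
    ∃ ρ > 0, ∀ p ∈ K, ∀ z, ‖z - p‖ < ρ →
      z ∈ W ∧ ‖f z - f p - fderiv ℝ f p (z - p)‖ ≤ κ * ‖z - p‖ := by
  obtain ⟨ρ, hρ, h⟩ := exists_forall_norm_sub_lt_of_isCompact hW
    (hf.continuousOn_fderiv_of_isOpen hW le_rfl) hK hKW hκ
  refine ⟨ρ, hρ, fun p hp z hz => ⟨(h p hp z hz).1, ?_⟩⟩
  refine (convex_ball p ρ).norm_image_sub_le_of_norm_hasFDerivWithin_le' (f' := fderiv ℝ f)
    (fun w hw => ?_) (fun w hw => ?_) (mem_ball_self hρ) (by rwa [mem_ball, dist_eq_norm])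
  · exact ((hf.differentiableOn one_ne_zero).differentiableAt (hW.mem_nhds
      (h p hp w (by rwa [mem_ball, dist_eq_norm] at hw)).1)).hasFDerivAt.hasFDerivWithinAt
  · exact (h p hp w (by rwa [mem_ball, dist_eq_norm] at hw)).2.le

theorem exists_forall_norm_fderiv_le_of_isCompact {W K : Set H} (hW : IsOpen W) {f : H → G}
    (hf : ContDiffOn ℝ 1 f W) (hK : IsCompact K) (hKW : K ⊆ W) :
    ∃ C > 0, ∀ p ∈ K, ‖fderiv ℝ f p‖ ≤ C := by
  obtain ⟨C, hC⟩ := hK.exists_bound_of_continuousOn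
    ((hf.continuousOn_fderiv_of_isOpen hW le_rfl).mono hKW)
  exact ⟨max C 1, by positivity, fun p hp => (hC p hp).trans (le_max_left _ _)⟩

variable {V : H → H} {W : Set H} {a b : ℝ} {X : ℝ → H}

/-- Lipschitz dependence of trajectories on their initial values, near a given trajectory. -/
theorem exists_norm_sub_le_mul_of_isTrajOn (hW : IsOpen W) (hV : ContDiffOn ℝ 1 V W)
    (hX : IsTrajOn (fun _ => V) W a b X) :
    ∃ C > 0, ∃ ρ > 0, ∀ Y, IsTrajOn (fun _ => V) W a b Y → ‖Y a - X a‖ < ρ →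
      ∀ t ∈ Icc a b, ‖Y t - X t‖ ≤ C * ‖Y a - X a‖ := by
  have hcomp : IsCompact (X '' Icc a b) := isCompact_Icc.image_of_continuousOn hX.continuousOn
  have hXW : X '' Icc a b ⊆ W := image_subset_iff.2 hX.mem
  obtain ⟨K, hK0, hK⟩ := exists_forall_norm_fderiv_le_of_isCompact hW hV hcomp hXW
  obtain ⟨r, hr, h⟩ := exists_forall_norm_sub_sub_fderiv_le_of_isCompact hW hV hcomp
    hXW one_pos
  set C := Real.exp ((K + 1) * (b - a)) with hC
  have hC0 : 0 < C := Real.exp_pos _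
  refine ⟨C, hC0, r / C, by positivity, fun Y hY hYX => ?_⟩
  have hcont : ContinuousOn (fun t => Y t - X t) (Icc a b) := hY.continuousOn.sub hX.continuousOn
  -- Gronwall applies as long as the trajectories stay `r`-close. The rate `K + 1` is the bound `K`
  -- on the derivative plus the linearization error, taken with constant `1`.
  have key : ∀ c ∈ Icc a b, (∀ t ∈ Ico a c, ‖Y t - X t‖ < r) →
      ‖Y c - X c‖ ≤ C * ‖Y a - X a‖ := by
    intro c hc hlt
    have := norm_le_gronwallBound_of_norm_deriv_right_le (f := fun t => Y t - X t)
      (f' := fun t => V (Y t) - V (X t)) (δ := ‖Y a - X a‖) (K := K + 1) (ε := 0) (a := a) (b := c)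
      (hcont.mono (Icc_subset_Icc_right hc.2))
      (fun t ht => ((hY.mono hc.2).hasDeriv t ht).sub ((hX.mono hc.2).hasDeriv t ht)) le_rfl
      (fun t ht => by
        have hta : t ∈ Icc a b := ⟨ht.1, ht.2.le.trans hc.2⟩
        have h1 := (h (X t) ⟨t, hta, rfl⟩ (Y t) (hlt t ht)).2
        have h2 : ‖fderiv ℝ V (X t) (Y t - X t)‖ ≤ K * ‖Y t - X t‖ :=
          (fderiv ℝ V (X t)).le_of_opNorm_le (hK _ ⟨t, hta, rfl⟩) _
        have h3 := norm_add_le (V (Y t) - V (X t) - fderiv ℝ V (X t) (Y t - X t))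
          (fderiv ℝ V (X t) (Y t - X t))
        rw [sub_add_cancel] at h3
        linarith) c ⟨hc.1, le_rfl⟩
    rw [gronwallBound_ε0] at this
    refine this.trans ?_
    rw [mul_comm]
    gcongr
    · rw [hC]; gcongr; exact hc.2
  -- At the first time the distance reaches `r`, `key` still bounds it by `C * ‖Y a - X a‖ < r`.
  have hlt : ∀ t ∈ Icc a b, ‖Y t - X t‖ < r := by
    by_contra! hcon
    have hcl : IsCompact (Icc a b ∩ (fun t => ‖Y t - X t‖) ⁻¹' Ici r) :=
      isCompact_Icc.of_isClosed_subset (hcont.norm.preimage_isClosed_of_isClosed isClosed_Icc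
        isClosed_Ici) inter_subset_left
    obtain ⟨c, ⟨hc, hcr⟩, hmin⟩ := hcl.exists_isLeast (let ⟨t, ht, h⟩ := hcon; ⟨t, ht, h⟩)
    have hle := key c hc fun t ht => by
      by_contra! hge
      exact absurd (hmin ⟨⟨ht.1, ht.2.le.trans hc.2⟩, hge⟩) (not_le.2 ht.2)
    have : C * ‖Y a - X a‖ < r := by rw [lt_div_iff₀ hC0] at hYX; linarith
    have hcr' : r ≤ ‖Y c - X c‖ := hcr
    linarith
  exact fun t ht => key t ht fun s hs => hlt s ⟨hs.1, hs.2.le.trans ht.2⟩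

/-- First order expansion of trajectories in their initial values, near a given trajectory. -/
theorem exists_norm_sub_sub_le_of_isTrajOn (hW : IsOpen W) (hV : ContDiffOn ℝ 1 V W)
    (hX : IsTrajOn (fun _ => V) W a b X) :
    ∃ C > 0, ∀ κ > 0, ∃ ρ > 0, ∀ Y, IsTrajOn (fun _ => V) W a b Y → ‖Y a - X a‖ < ρ →
      ∀ Z, IsTrajOn (fun t z => fderiv ℝ V (X t) z) univ a b Z →
      ∀ t ∈ Icc a b, ‖Y t - X t - Z t‖ ≤ C * ‖Y a - X a - Z a‖ + κ * ‖Y a - X a‖ := by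
  obtain ⟨C₀, hC₀, ρ₀, hρ₀, hlip⟩ := exists_norm_sub_le_mul_of_isTrajOn hW hV hX
  have hcomp : IsCompact (X '' Icc a b) := isCompact_Icc.image_of_continuousOn hX.continuousOn
  have hXW : X '' Icc a b ⊆ W := image_subset_iff.2 hX.mem
  obtain ⟨K, hK0, hK⟩ := exists_forall_norm_fderiv_le_of_isCompact hW hV hcomp hXW
  set C := Real.exp (K * (b - a)) with hC
  have hCp : 0 < C := Real.exp_pos _
  refine ⟨C, hCp, fun κ hκ => ?_⟩
  -- The forcing term is `κ' * C₀ * ‖Y a - X a‖`, and Gronwall multiplies it by at most `C / K`;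
  -- this choice makes the product `κ * ‖Y a - X a‖`.
  set κ' := κ * K / (C * C₀) with hκ'
  have hκ'0 : 0 < κ' := by positivity
  obtain ⟨r, hr, h⟩ := exists_forall_norm_sub_sub_fderiv_le_of_isCompact hW hV hcomp
    hXW hκ'0
  refine ⟨min ρ₀ (r / C₀), by positivity, fun Y hY hYX Z hZ t ht => ?_⟩
  have hY1 := hlip Y hY (hYX.trans_le (min_le_left _ _))
  have hY2 : ∀ t ∈ Icc a b, ‖Y t - X t‖ < r := fun t ht => (hY1 t ht).trans_lt (by
    have := hYX.trans_le (min_le_right _ _)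
    rw [lt_div_iff₀ hC₀] at this; linarith)
  have := norm_le_gronwallBound_of_norm_deriv_right_le (f := fun t => Y t - X t - Z t)
      (f' := fun t => V (Y t) - V (X t) - fderiv ℝ V (X t) (Z t)) (δ := ‖Y a - X a - Z a‖)
      (K := K) (ε := κ' * (C₀ * ‖Y a - X a‖)) (a := a) (b := b)
      ((hY.continuousOn.sub hX.continuousOn).sub hZ.continuousOn)
      (fun t ht => ((hY.hasDeriv t ht).sub (hX.hasDeriv t ht)).sub (hZ.hasDeriv t ht)) le_rfl
      (fun t ht => by
        have hta : t ∈ Icc a b := ⟨ht.1, ht.2.le⟩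
        have h1 := (h (X t) ⟨t, hta, rfl⟩ (Y t) (hY2 t hta)).2
        have h2 : ‖fderiv ℝ V (X t) (Y t - X t - Z t)‖ ≤ K * ‖Y t - X t - Z t‖ :=
          (fderiv ℝ V (X t)).le_of_opNorm_le (hK _ ⟨t, hta, rfl⟩) _
        have h3 := norm_add_le (V (Y t) - V (X t) - fderiv ℝ V (X t) (Y t - X t))
          (fderiv ℝ V (X t) (Y t - X t - Z t))
        rw [map_sub _ (Y t - X t) (Z t)] at h3 h2
        rw [sub_add_sub_cancel] at h3
        have h4 := mul_le_mul_of_nonneg_left (hY1 t hta) hκ'0.le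
        linarith) t ht
  refine this.trans ?_
  have hmono := gronwallBound_mono (δ := ‖Y a - X a - Z a‖) (K := K)
    (ε := κ' * (C₀ * ‖Y a - X a‖)) (norm_nonneg _) (by positivity) hK0.le
    (sub_le_sub_right ht.2 a)
  refine hmono.trans ?_
  rw [gronwallBound_of_K_ne_0 hK0.ne']
  have e : κ' * (C₀ * ‖Y a - X a‖) / K * C = κ * ‖Y a - X a‖ := by
    rw [hκ']; field_simp
  have e2 : 0 ≤ κ' * (C₀ * ‖Y a - X a‖) / K := by positivity
  simp only [← hC]
  rw [mul_sub, e]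
  linarith

end PerturbedTrajectories

/-! ### Linear equations and Liouville's formula -/

section LinearEquations

open Filter Topology Metric MeasureTheory
open scoped NNReal Matrix

variable {N : ℕ}

/-- The trace of endomorphisms of `ℝᴺ`, as a continuous linear form. -/
noncomputable def traceCLM (N : ℕ) :
    (EuclideanSpace ℝ (Fin N) →L[ℝ] EuclideanSpace ℝ (Fin N)) →L[ℝ] ℝ :=
  LinearMap.toContinuousLinearMap
    ((LinearMap.trace ℝ (EuclideanSpace ℝ (Fin N))).comp (ContinuousLinearMap.coeLM ℝ))

/-- Coordinatewise truncation to `[-R, R]`. -/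
noncomputable def clampCoords (R : ℝ) (z : EuclideanSpace ℝ (Fin N)) :
    EuclideanSpace ℝ (Fin N) :=
  WithLp.toLp 2 fun i => max (-R) (min R (z i))

theorem norm_clampCoords_sub_le (R : ℝ) (z w : EuclideanSpace ℝ (Fin N)) :
    ‖clampCoords R z - clampCoords R w‖ ≤ ‖z - w‖ := by
  rw [EuclideanSpace.norm_eq, EuclideanSpace.norm_eq]
  refine Real.sqrt_le_sqrt (Finset.sum_le_sum fun i _ => ?_)
  simp only [clampCoords, PiLp.sub_apply, Real.norm_eq_abs]
  refine pow_le_pow_left₀ (abs_nonneg _) ?_ 2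
  have h1 := abs_max_sub_max_le_max (-R) (min R (z i)) (-R) (min R (w i))
  have h2 := abs_min_sub_min_le_max R (z i) R (w i)
  rw [sub_self, abs_zero] at h1 h2
  rw [max_eq_right (abs_nonneg (min R (z i) - min R (w i)))] at h1
  rw [max_eq_right (abs_nonneg (z i - w i))] at h2
  exact h1.trans h2

theorem norm_clampCoords_le_norm {R : ℝ} (hR : 0 ≤ R) (z : EuclideanSpace ℝ (Fin N)) :
    ‖clampCoords R z‖ ≤ ‖z‖ := by
  have h := norm_clampCoords_sub_le R z 0
  have h0 : clampCoords R (0 : EuclideanSpace ℝ (Fin N)) = 0 := by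
    ext i; simp [clampCoords, hR]
  rwa [h0, sub_zero, sub_zero] at h

theorem norm_clampCoords_le {R : ℝ} (hR : 0 ≤ R) (z : EuclideanSpace ℝ (Fin N)) :
    ‖clampCoords R z‖ ≤ √(N * R ^ 2) := by
  rw [EuclideanSpace.norm_eq]
  refine Real.sqrt_le_sqrt ?_
  calc ∑ i, ‖(clampCoords R z) i‖ ^ 2 ≤ ∑ _i : Fin N, R ^ 2 := by
        refine Finset.sum_le_sum fun i _ => ?_
        gcongr
        rw [Real.norm_eq_abs, abs_le]
        exact ⟨le_max_left _ _, max_le (by linarith) (min_le_left _ _)⟩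
    _ = N * R ^ 2 := by simp

theorem clampCoords_of_norm_le {R : ℝ} {z : EuclideanSpace ℝ (Fin N)} (h : ‖z‖ ≤ R) :
    clampCoords R z = z := by
  ext i
  have := abs_le.1 ((PiLp.norm_apply_le z i).trans h)
  simp [clampCoords, this.1, this.2]

/-- Global existence for linear differential equations. -/
theorem exists_isTrajOn_linear {a b : ℝ} (hab : a ≤ b)
    {B : ℝ → EuclideanSpace ℝ (Fin N) →L[ℝ] EuclideanSpace ℝ (Fin N)}
    (hB : ContinuousOn B (Icc a b)) (v : EuclideanSpace ℝ (Fin N)) :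
    ∃ z, z a = v ∧ IsTrajOn (fun t w => B t w) univ a b z := by
  obtain ⟨K₀, hK₀⟩ := isCompact_Icc.exists_bound_of_continuousOn hB
  obtain ⟨K, hK⟩ : ∃ K : ℝ≥0, ∀ t ∈ Icc a b, ‖B t‖ ≤ K :=
    ⟨K₀.toNNReal, fun t ht => (hK₀ t ht).trans (Real.le_coe_toNNReal _)⟩
  set R : ℝ := ‖v‖ * Real.exp (K * (b - a)) with hR
  have hR0 : 0 ≤ R := by positivity
  set L : ℝ≥0 := K * (√(N * R ^ 2)).toNNReal with hL
  have hpl : IsPicardLindelof (fun t w => B t (clampCoords R w)) (⟨a, le_rfl, hab⟩ : Icc a b) v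
      (L * (b - a).toNNReal) 0 L K := by
    refine ⟨fun t ht => ?_, fun w _ => ?_, fun t ht w _ => ?_, ?_⟩
    · refine LipschitzOnWith.of_dist_le_mul fun z _ w _ => ?_
      rw [dist_eq_norm, dist_eq_norm, ← map_sub]
      refine ((B t).le_of_opNorm_le (hK t ht) _).trans ?_
      gcongr
      exact norm_clampCoords_sub_le R z w
    · exact hB.clm_apply continuousOn_const
    · refine ((B t).le_of_opNorm_le (hK t ht) _).trans ?_
      rw [hL, NNReal.coe_mul, Real.coe_toNNReal _ (Real.sqrt_nonneg _)]
      gcongr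
      exact norm_clampCoords_le hR0 w
    · simp [hab]
  obtain ⟨z, hza, hz⟩ := hpl.exists_eq_forall_mem_Icc_hasDerivWithinAt₀
  have hcont : ContinuousOn z (Icc a b) := fun t ht => (hz t ht).continuousWithinAt
  have hz' : ∀ t ∈ Ico a b, HasDerivWithinAt z (B t (clampCoords R (z t))) (Ici t) t :=
    fun t ht => (hz t ⟨ht.1, ht.2.le⟩).mono_of_mem_nhdsWithin (Icc_mem_nhdsGE_of_mem ht)
  have hbound : ∀ t ∈ Icc a b, ‖z t‖ ≤ R := by
    intro t ht
    have := norm_le_gronwallBound_of_norm_deriv_right_le (δ := ‖v‖) (K := K) (ε := 0) hcont hz'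
      (by rw [← hza]) (fun t ht => by
        rw [add_zero]
        refine ((B t).le_of_opNorm_le (hK t ⟨ht.1, ht.2.le⟩) _).trans ?_
        gcongr
        exact norm_clampCoords_le_norm hR0 _) t ht
    rw [gronwallBound_ε0] at this
    refine this.trans ?_
    rw [hR]
    gcongr
    exact ht.2
  refine ⟨z, hza, hcont, fun t _ => mem_univ _, fun t ht => ?_⟩
  have := hz' t ht
  rwa [clampCoords_of_norm_le (hbound t ⟨ht.1, ht.2.le⟩)] at this

/-- The determinant is multilinear in the rows, so its derivative is a sum of determinants with one
row replaced. By Cramer's rule these are the diagonal entries of `adj(Rᵀ) A Rᵀ`, whose trace is `tr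
A * det R` by cyclicity. -/
theorem hasDerivWithinAt_det_of_rows {n : Type*} [Fintype n] [DecidableEq n]
    {R : ℝ → Matrix n n ℝ} {A : Matrix n n ℝ} {s : Set ℝ} {t : ℝ}
    (h : ∀ i, HasDerivWithinAt (fun u => R u i) ((R t * Aᵀ) i) s t) :
    HasDerivWithinAt (fun u => (R u).det) (A.trace * (R t).det) s t := by
  let f : ContinuousMultilinearMap ℝ (fun _ : n => n → ℝ) ℝ :=
    ⟨(Matrix.detRowAlternating (n := n) (R := ℝ)).toMultilinearMap, by
      exact Continuous.matrix_det (A := fun M : Matrix n n ℝ => M) continuous_id⟩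
  have h1 : HasDerivWithinAt (fun u => f (R u)) (f.linearDeriv (R t) (R t * Aᵀ)) s t :=
    (f.hasFDerivAt (R t)).comp_hasDerivWithinAt t (hasDerivWithinAt_pi.2 h)
  refine h1.congr_deriv ?_
  refine (ContinuousMultilinearMap.linearDeriv_apply f _ _).trans ?_
  have h2 : ∀ i, f (Function.update (R t) i ((R t * Aᵀ) i)) =
      ((R t)ᵀ.adjugate * (A * (R t)ᵀ)) i i := by
    intro i
    have : f (Function.update (R t) i ((R t * Aᵀ) i)) =
      ((R t).updateRow i ((R t * Aᵀ) i)).det := rfl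
    rw [this, ← Matrix.cramer_transpose_apply, Matrix.cramer_eq_adjugate_mulVec,
      Matrix.mul_apply, Matrix.mulVec, dotProduct]
    refine Finset.sum_congr rfl fun j _ => ?_
    congr 1
    rw [← Matrix.transpose_apply (A * (R t)ᵀ), Matrix.transpose_mul, Matrix.transpose_transpose]
  rw [Finset.sum_congr rfl fun i _ => h2 i]
  change Matrix.trace ((R t)ᵀ.adjugate * (A * (R t)ᵀ)) = _
  rw [Matrix.trace_mul_comm, Matrix.mul_assoc, Matrix.mul_adjugate, Matrix.det_transpose]
  simp [mul_comm]

/-- The fundamental solution of a linear differential equation, with Liouville's formula. -/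
theorem exists_fundamentalSolution {a b : ℝ} (hab : a ≤ b)
    {B : ℝ → EuclideanSpace ℝ (Fin N) →L[ℝ] EuclideanSpace ℝ (Fin N)}
    (hB : ContinuousOn B (Icc a b)) :
    ∃ Z : ℝ → EuclideanSpace ℝ (Fin N) →L[ℝ] EuclideanSpace ℝ (Fin N),
      (∀ v, Z a v = v) ∧ (∀ v, IsTrajOn (fun t w => B t w) univ a b (fun t => Z t v)) ∧
      (Z b).det = Real.exp (∫ t in a..b, traceCLM N (B t)) := by
  set e := (EuclideanSpace.basisFun (Fin N) ℝ).toBasis with he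
  choose z hza hz using fun i => exists_isTrajOn_linear hab hB (e i)
  set Z : ℝ → EuclideanSpace ℝ (Fin N) →L[ℝ] EuclideanSpace ℝ (Fin N) :=
    fun t => ∑ i, (EuclideanSpace.proj i : EuclideanSpace ℝ (Fin N) →L[ℝ] ℝ).smulRight (z i t)
    with hZ
  have hZv : ∀ t v, Z t v = ∑ i, v i • z i t := by intro t v; simp [hZ]
  have hZe : ∀ t i, Z t (e i) = z i t := by
    intro t i
    rw [hZv]
    simp [he]
  refine ⟨Z, fun v => ?_, fun v => ⟨?_, fun _ _ => mem_univ _, fun t ht => ?_⟩, ?_⟩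
  · have : (Z a : EuclideanSpace ℝ (Fin N) →ₗ[ℝ] EuclideanSpace ℝ (Fin N)) = LinearMap.id :=
      e.ext fun i => by simp [hZe, hza]
    exact LinearMap.congr_fun this v
  · simp only [hZv]
    exact continuousOn_finsetSum _ fun i _ => (hz i).continuousOn.fun_const_smul (v i)
  · simp only [hZv, map_sum, map_smul]
    exact HasDerivWithinAt.fun_sum fun i _ => ((hz i).hasDeriv t ht).const_smul (v i)
  -- The solutions `z i` are placed as rows, the transpose of the matrix of `Z t`, to match the row
  -- form of the determinant derivative.
  · set R : ℝ → Matrix (Fin N) (Fin N) ℝ := fun t => Matrix.of fun i j => z i t j with hR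
    have hdet : ∀ t, (Z t).det = (R t).det := by
      intro t
      rw [ContinuousLinearMap.det, ← LinearMap.det_toMatrix e, ← Matrix.det_transpose]
      congr 1
      ext i j
      rw [Matrix.transpose_apply, LinearMap.toMatrix_apply, ContinuousLinearMap.coe_coe, hZe]
      simp [he, hR]
    set tr : ℝ → ℝ := fun t => traceCLM N (B t) with htr
    have htrc : ContinuousOn tr (Icc a b) := by
      exact (traceCLM N).continuous.comp_continuousOn hB
    have hderiv : ∀ t ∈ Ico a b,
        HasDerivWithinAt (fun u => (R u).det) (tr t * (R t).det) (Ici t) t := by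
      intro t ht
      have key : tr t = (LinearMap.toMatrix e e (B t)).trace :=
        LinearMap.trace_eq_matrix_trace ℝ e _
      rw [key]
      refine hasDerivWithinAt_det_of_rows fun i => hasDerivWithinAt_pi.2 fun j => ?_
      have h1 := ((EuclideanSpace.proj j : EuclideanSpace ℝ (Fin N) →L[ℝ] ℝ).hasFDerivAt
        (x := z i t)).comp_hasDerivWithinAt t ((hz i).hasDeriv t ht)
      refine h1.congr_deriv ?_
      have h2 := congrFun (LinearMap.toMatrix_mulVec_repr e e
        (B t : EuclideanSpace ℝ (Fin N) →ₗ[ℝ] EuclideanSpace ℝ (Fin N)) (z i t)) j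
      have h3 : (B t (z i t)) j = e.repr (B t (z i t)) j := by simp [he]
      change (B t (z i t)) j = _
      rw [h3]
      rw [ContinuousLinearMap.coe_coe] at h2
      rw [← h2, Matrix.mul_apply, Matrix.mulVec, dotProduct]
      refine Finset.sum_congr rfl fun k _ => ?_
      rw [Matrix.transpose_apply, mul_comm]
      simp [he, hR]
    have hRcont : ContinuousOn (fun u => (R u).det) (Icc a b) := by
      refine (continuous_id.matrix_det).comp_continuousOn
        (continuousOn_pi.2 fun i => continuousOn_pi.2 fun j => ?_)
      exact (EuclideanSpace.proj j : EuclideanSpace ℝ (Fin N) →L[ℝ] ℝ).continuous.comp_continuousOn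
        (hz i).continuousOn
    have hint : IntervalIntegrable tr volume a b :=
      ContinuousOn.intervalIntegrable (by rwa [uIcc_of_le hab])
    set I : ℝ → ℝ := fun t => ∫ s in a..t, tr s with hI
    have hIcont : ContinuousOn I (Icc a b) := by
      have := intervalIntegral.continuousOn_primitive_interval
        (hint.1.mono_set (by rfl) |>.congr_set_ae (Ioc_ae_eq_Icc.symm) |> fun h => by
          rwa [← uIcc_of_le hab] at h)
      rwa [uIcc_of_le hab] at this
    have hIderiv : ∀ t ∈ Ico a b, HasDerivWithinAt I (tr t) (Ici t) t := by
      intro t ht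
      have hc : ContinuousWithinAt tr (Ici t) t :=
        (htrc t ⟨ht.1, ht.2.le⟩).mono_of_mem_nhdsWithin (Icc_mem_nhdsGE_of_mem ht)
      refine intervalIntegral.integral_hasDerivWithinAt_right
        (hint.mono_set (by rw [uIcc_of_le ht.1, uIcc_of_le hab]; exact Icc_subset_Icc_right ht.2.le))
        ?_ (hc.mono Ioi_subset_Ici_self)
      exact ⟨Ioc t b, Ioc_mem_nhdsGT ht.2, ((htrc.mono
        (Ioc_subset_Icc_self.trans (Icc_subset_Icc_left ht.1))).aestronglyMeasurable
          measurableSet_Ioc)⟩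
    -- Since `det R` has logarithmic derivative `tr`, multiplying by `exp (-I)` gives a constant.
    have hconst := constant_of_has_deriv_right_zero
      (f := fun t => (R t).det * Real.exp (-(I t))) (a := a) (b := b)
      (hRcont.mul (Real.continuous_exp.comp_continuousOn hIcont.neg)) (fun t ht => by
        refine ((hderiv t ht).mul ((hIderiv t ht).neg.exp)).congr_deriv ?_
        ring) b ⟨hab, le_rfl⟩
    have hRa : (R a).det = 1 := by
      have : R a = 1 := by
        ext i j
        simp only [hR, Matrix.of_apply, hza, he]
        simp [Matrix.one_apply, eq_comm]
      rw [this, Matrix.det_one]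
    have hIa : I a = 0 := by simp [hI]
    rw [hdet]
    simp only [hRa, hIa, neg_zero, Real.exp_zero, mul_one] at hconst
    rw [Real.exp_neg, ← div_eq_mul_inv, div_eq_one_iff_eq (Real.exp_pos _).ne'] at hconst
    exact hconst

end LinearEquations

/-! ### Differentiability of the flow in its initial value -/

section FlowDerivative

open Filter Topology Metric MeasureTheory

/-- Adjoining time as a state variable makes the equation autonomous, so that the Gronwall estimates
for autonomous fields apply. -/
theorem IsTrajOn.prodMk_time {H : Type*} [NormedAddCommGroup H] [NormedSpace ℝ H]
    {F : ℝ → H → H} {D : Set H} {a b : ℝ} {y : ℝ → H} (h : IsTrajOn F D a b y) :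
    IsTrajOn (fun _ (q : H × ℝ) => (F q.2 q.1, (1 : ℝ))) (D ×ˢ univ) a b (fun t => (y t, t)) :=
  ⟨h.continuousOn.prodMk continuousOn_id, fun t ht => ⟨h.mem t ht, mem_univ _⟩,
    fun t ht => (h.hasDeriv t ht).prodMk (hasDerivWithinAt_id t _)⟩

section

variable {H : Type*} [NormedAddCommGroup H] [NormedSpace ℝ H]
  {D : Set H} {F : ℝ → H → H}

theorem contDiffOn_prodMk_time (hF : ContDiffOn ℝ 1 (fun q : H × ℝ => F q.2 q.1) (D ×ˢ univ)) :
    ContDiffOn ℝ 1 (fun q : H × ℝ => (F q.2 q.1, (1 : ℝ))) (D ×ˢ univ) :=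
  hF.prodMk contDiffOn_const

theorem hasFDerivAt_slice (hD : IsOpen D)
    (hF : ContDiffOn ℝ 1 (fun q : H × ℝ => F q.2 q.1) (D ×ˢ univ)) {z : H} (hz : z ∈ D) (t : ℝ) :
    HasFDerivAt (F t) ((fderiv ℝ (fun q : H × ℝ => F q.2 q.1) (z, t)).comp
      (ContinuousLinearMap.inl ℝ H ℝ)) z := by
  have h1 : HasFDerivAt (fun q : H × ℝ => F q.2 q.1) _ (z, t) :=
    ((hF.differentiableOn one_ne_zero).differentiableAt
      ((hD.prod isOpen_univ).mem_nhds ⟨hz, mem_univ t⟩)).hasFDerivAt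
  exact HasFDerivAt.comp (g := fun q : H × ℝ => F q.2 q.1) (f := fun e => (e, t)) z h1
    (hasFDerivAt_prodMk_left z t)

theorem fderiv_prodMk_time_apply (hD : IsOpen D)
    (hF : ContDiffOn ℝ 1 (fun q : H × ℝ => F q.2 q.1) (D ×ˢ univ)) {z : H} (hz : z ∈ D) (t : ℝ)
    (w : H) : fderiv ℝ (fun q : H × ℝ => (F q.2 q.1, (1 : ℝ))) (z, t) (w, 0) =
      (fderiv ℝ (F t) z w, 0) := by
  have h1 : HasFDerivAt (fun q : H × ℝ => F q.2 q.1) _ (z, t) :=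
    ((hF.differentiableOn one_ne_zero).differentiableAt
      ((hD.prod isOpen_univ).mem_nhds ⟨hz, mem_univ t⟩)).hasFDerivAt
  rw [(h1.prodMk (hasFDerivAt_const (1 : ℝ) (z, t))).fderiv, (hasFDerivAt_slice hD hF hz t).fderiv]
  simp

theorem continuousOn_fderiv_slice (hD : IsOpen D)
    (hF : ContDiffOn ℝ 1 (fun q : H × ℝ => F q.2 q.1) (D ×ˢ univ)) :
    ContinuousOn (fun q : H × ℝ => fderiv ℝ (F q.2) q.1) (D ×ˢ univ) := by
  have h := (hF.continuousOn_fderiv_of_isOpen (hD.prod isOpen_univ) le_rfl).clm_comp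
    (continuousOn_const (c := ContinuousLinearMap.inl ℝ H ℝ))
  exact h.congr fun q hq => (hasFDerivAt_slice hD hF hq.1 q.2).fderiv

/-- Local Lipschitz dependence of a family of trajectories on its initial values. -/
theorem exists_eventually_norm_flow_sub_le (hD : IsOpen D)
    (hF : ContDiffOn ℝ 1 (fun q : H × ℝ => F q.2 q.1) (D ×ˢ univ)) {a b : ℝ}
    {Φ : H → ℝ → H} {p : H}
    (hΦ : ∀ᶠ y in 𝓝 p, Φ y a = y ∧ IsTrajOn F D a b (Φ y)) :
    ∃ C > 0, ∀ᶠ y in 𝓝 p, ∀ t ∈ Icc a b, ‖Φ y t - Φ p t‖ ≤ C * ‖y - p‖ := by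
  obtain ⟨hpa, hp⟩ := hΦ.self_of_nhds
  obtain ⟨C, hC, ρ, hρ, h⟩ := exists_norm_sub_le_mul_of_isTrajOn (hD.prod isOpen_univ)
    (contDiffOn_prodMk_time hF) hp.prodMk_time
  refine ⟨C, hC, ?_⟩
  filter_upwards [hΦ, ball_mem_nhds p hρ] with y hy hyρ t ht
  rw [mem_ball, dist_eq_norm] at hyρ
  have h1 := h _ hy.2.prodMk_time
  simp only [hy.1, hpa, Prod.mk_sub_mk, sub_self, Prod.norm_mk, norm_zero, norm_nonneg,
    sup_of_le_left] at h1
  exact h1 hyρ t ht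

end

variable {N : ℕ} {D : Set (EuclideanSpace ℝ (Fin N))}
  {F : ℝ → EuclideanSpace ℝ (Fin N) → EuclideanSpace ℝ (Fin N)}

/-- Differentiability of a family of trajectories in its initial values, with Liouville's formula
for the determinant of the derivative. -/
theorem exists_hasFDerivAt_flow (hD : IsOpen D)
    (hF : ContDiffOn ℝ 1 (fun q : EuclideanSpace ℝ (Fin N) × ℝ => F q.2 q.1) (D ×ˢ univ))
    {a b : ℝ} (hab : a ≤ b)
    {Φ : EuclideanSpace ℝ (Fin N) → ℝ → EuclideanSpace ℝ (Fin N)} {p : EuclideanSpace ℝ (Fin N)}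
    (hΦ : ∀ᶠ y in 𝓝 p, Φ y a = y ∧ IsTrajOn F D a b (Φ y)) :
    ∃ M : EuclideanSpace ℝ (Fin N) →L[ℝ] EuclideanSpace ℝ (Fin N),
      HasFDerivAt (fun y => Φ y b) M p ∧
      M.det = Real.exp (∫ t in a..b, traceCLM N (fderiv ℝ (F t) (Φ p t))) := by
  obtain ⟨hpa, hp⟩ := hΦ.self_of_nhds
  have hB : ContinuousOn (fun t => fderiv ℝ (F t) (Φ p t)) (Icc a b) :=
    (continuousOn_fderiv_slice hD hF).comp (hp.continuousOn.prodMk continuousOn_id)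
      fun t ht => ⟨hp.mem t ht, mem_univ _⟩
  obtain ⟨Z, hZa, hZ, hdet⟩ := exists_fundamentalSolution hab hB
  refine ⟨Z b, ?_, hdet⟩
  obtain ⟨C, hC, h⟩ := exists_norm_sub_sub_le_of_isTrajOn (hD.prod isOpen_univ)
    (contDiffOn_prodMk_time hF) hp.prodMk_time
  rw [hasFDerivAt_iff_isLittleO, Asymptotics.isLittleO_iff]
  intro κ hκ
  obtain ⟨ρ, hρ, h⟩ := h κ hκ
  filter_upwards [hΦ, ball_mem_nhds p hρ] with y hy hyρ
  rw [mem_ball, dist_eq_norm] at hyρ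
  -- The variational solution starts exactly at `(y - p, 0)`, so the initial error term vanishes and
  -- only `κ * ‖y - p‖` remains.
  have h1 := h _ hy.2.prodMk_time (by simpa [hy.1, hpa] using hyρ) (fun t => (Z t (y - p), 0))
    ⟨(hZ (y - p)).continuousOn.prodMk continuousOn_const, fun _ _ => mem_univ _, fun t ht => by
      rw [fderiv_prodMk_time_apply hD hF (hp.mem t ⟨ht.1, ht.2.le⟩)]
      exact ((hZ (y - p)).hasDeriv t ht).prodMk (hasDerivWithinAt_const t _ (0 : ℝ))⟩
    b ⟨hab, le_rfl⟩
  simpa [hy.1, hpa, hZa] using h1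

end FlowDerivative

/-! ### Positive mean divergence implies instability -/

section Instability

open Filter Topology Metric MeasureTheory
open scoped NNReal

variable {N : ℕ} {D : Set (EuclideanSpace ℝ (Fin N))}
  {F : ℝ → EuclideanSpace ℝ (Fin N) → EuclideanSpace ℝ (Fin N)}

theorem fderiv_add_period {H : Type*} [NormedAddCommGroup H] [NormedSpace ℝ H] {D : Set H}
    {F : ℝ → H → H} (hD : IsOpen D) {τ : ℝ}
    (hper : ∀ z ∈ D, ∀ t, F (t + τ) z = F t z) {z : H}
    (hz : z ∈ D) (t : ℝ) : fderiv ℝ (F (t + τ)) z = fderiv ℝ (F t) z :=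
  Filter.EventuallyEq.fderiv_eq
    (Filter.eventually_of_mem (hD.mem_nhds hz) fun w hw => hper w hw t)

/-- Uniform continuity of the spatial derivative of a periodic vector field along a periodic
solution. -/
theorem exists_forall_norm_fderiv_sub_lt_of_periodic (hD : IsOpen D)
    (hF : ContDiffOn ℝ 1 (fun q : EuclideanSpace ℝ (Fin N) × ℝ => F q.2 q.1) (D ×ˢ univ))
    {τ : ℝ} (hτ : 0 < τ) (hper : ∀ z ∈ D, ∀ t, F (t + τ) z = F t z)
    {x : ℝ → EuclideanSpace ℝ (Fin N)} (hx : Continuous x) (hxD : ∀ t, x t ∈ D)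
    (hxper : Function.Periodic x τ) {κ : ℝ} (hκ : 0 < κ) :
    ∃ η > 0, ∀ t z, ‖z - x t‖ < η →
      z ∈ D ∧ ‖fderiv ℝ (F t) z - fderiv ℝ (F t) (x t)‖ < κ := by
  have hcomp : IsCompact ((fun t => (x t, t)) '' Icc 0 (0 + τ)) :=
    isCompact_Icc.image (hx.prodMk continuous_id)
  obtain ⟨η, hη, h⟩ := exists_forall_norm_sub_lt_of_isCompact (hD.prod isOpen_univ)
    (continuousOn_fderiv_slice hD hF) hcomp
    (by rintro _ ⟨t, _, rfl⟩; exact ⟨hxD t, mem_univ _⟩) hκ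
  refine ⟨η, hη, fun t => ?_⟩
  -- The whole assertion at time `t` is periodic in `t`, so one compact period suffices.
  have hQ : Function.Periodic (fun t => ∀ z, ‖z - x t‖ < η →
      z ∈ D ∧ ‖fderiv ℝ (F t) z - fderiv ℝ (F t) (x t)‖ < κ) τ := by
    intro t
    refine propext (forall_congr' fun z => ?_)
    rw [hxper t]
    refine imp_congr_right fun _ => and_congr_right fun hz => ?_
    rw [fderiv_add_period hD hper hz, fderiv_add_period hD hper (hxD t)]
  obtain ⟨s, hs, hst⟩ := hQ.exists_mem_Ico hτ t 0
  refine hst.mpr fun z hz => ?_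
  have := h _ ⟨s, ⟨hs.1, hs.2.le⟩, rfl⟩ (z, s) (by simpa using hz)
  exact ⟨this.1.1, this.2⟩

theorem IsTrajOn.of_hasDerivWithinAt_Ici {y : ℝ → EuclideanSpace ℝ (Fin N)} {a : ℝ}
    (h : ∀ t, a ≤ t → y t ∈ D ∧ HasDerivWithinAt y (F t (y t)) (Ici a) t) (b : ℝ) :
    IsTrajOn F D a b y :=
  ⟨fun t ht => (h t ht.1).2.continuousWithinAt.mono Icc_subset_Ici_self,
    fun t ht => (h t ht.1).1, fun t ht => (h t ht.1).2.mono (Ici_subset_Ici.2 ht.1)⟩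

/-- Backward uniqueness, which makes the time-`b` map injective, as the change of variables formula
requires. -/
theorem eq_of_eq_right_of_hasDerivWithinAt_Ici {K : ℝ≥0} {s : ℝ → Set (EuclideanSpace ℝ (Fin N))}
    {a b : ℝ} (hab : a ≤ b) (hK : ∀ t ∈ Icc a b, LipschitzOnWith K (F t) (s t))
    {y z : ℝ → EuclideanSpace ℝ (Fin N)}
    (hy : ∀ t, a ≤ t → y t ∈ s t ∧ HasDerivWithinAt y (F t (y t)) (Ici a) t)
    (hz : ∀ t, a ≤ t → z t ∈ s t ∧ HasDerivWithinAt z (F t (z t)) (Ici a) t)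
    (h : y b = z b) : y a = z a :=
  ODE_solution_unique_of_mem_Icc_left (fun t ht => hK t ⟨ht.1.le, ht.2⟩)
    (fun t ht => (hy t ht.1).2.continuousWithinAt.mono Icc_subset_Ici_self)
    (fun t ht => ((hy t ht.1.le).2.hasDerivAt (Ici_mem_nhds ht.1)).hasDerivWithinAt)
    (fun t ht => (hy t ht.1.le).1)
    (fun t ht => (hz t ht.1).2.continuousWithinAt.mono Icc_subset_Ici_self)
    (fun t ht => ((hz t ht.1.le).2.hasDerivAt (Ici_mem_nhds ht.1)).hasDerivWithinAt)
    (fun t ht => (hz t ht.1.le).1) h ⟨le_rfl, hab⟩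

/-- A periodic solution along which the mean divergence of the periodic vector field is positive
is unstable: otherwise the flow would expand the volume of a small ball without bound, inside
a bounded set. -/
theorem isUnstable_of_integral_trace_pos (hD : IsOpen D)
    (hF : ContDiffOn ℝ 1 (fun q : EuclideanSpace ℝ (Fin N) × ℝ => F q.2 q.1) (D ×ˢ univ))
    {τ : ℝ} (hτ : 0 < τ) (hper : ∀ z ∈ D, ∀ t, F (t + τ) z = F t z)
    {x : ℝ → EuclideanSpace ℝ (Fin N)} (hx : IsSolution D F x)
    (hxper : Function.Periodic x τ) {t₀ : ℝ}
    (hI : 0 < ∫ t in t₀..(t₀ + τ), traceCLM N (fderiv ℝ (F t) (x t))) :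
    IsUnstable D F t₀ x := by
  intro hst
  set I := ∫ t in t₀..(t₀ + τ), traceCLM N (fderiv ℝ (F t) (x t)) with hIdef
  have hxc : Continuous x := continuous_iff_continuousAt.2 fun t => (hx t).2.continuousAt
  have hxD : ∀ t, x t ∈ D := fun t => (hx t).1
  have hBc : Continuous fun t => fderiv ℝ (F t) (x t) := by
    rw [← continuousOn_univ]
    exact (continuousOn_fderiv_slice hD hF).comp (hxc.prodMk continuous_id).continuousOn
      fun t _ => ⟨hxD t, mem_univ _⟩
  have hgc : Continuous fun t => traceCLM N (fderiv ℝ (F t) (x t)) :=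
    (traceCLM N).continuous.comp hBc
  -- With this tolerance the divergence drops by at most `I / (2 * τ)`, half its mean; the `+ 1`
  -- avoids dividing by a zero norm.
  set κ := I / (2 * τ) / (‖traceCLM N‖ + 1) with hκ
  have hκ0 : 0 < κ := by positivity
  obtain ⟨η, hη, hclose⟩ :=
    exists_forall_norm_fderiv_sub_lt_of_periodic hD hF hτ hper hxc hxD hxper hκ0
  have htr : ∀ t z, ‖z - x t‖ < η → traceCLM N (fderiv ℝ (F t) (x t)) - I / (2 * τ) ≤
      traceCLM N (fderiv ℝ (F t) z) := by
    intro t z hz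
    have h1 : ‖traceCLM N (fderiv ℝ (F t) z - fderiv ℝ (F t) (x t))‖ ≤ I / (2 * τ) :=
      calc _ ≤ ‖traceCLM N‖ * κ :=
            (traceCLM N).le_opNorm_of_le (hclose t z hz).2.le
        _ ≤ (‖traceCLM N‖ + 1) * κ := by gcongr; linarith
        _ = I / (2 * τ) := by rw [hκ]; field_simp
    rw [map_sub, Real.norm_eq_abs] at h1
    linarith [(abs_le.1 h1).1]
  obtain ⟨ρ, hρ, hstab⟩ := hst η hη
  -- Radius `ρ` gives stability; radius `η` guarantees that the initial values lie in `D`.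
  set A := ball (x t₀) (min ρ η) with hA
  have hsol : ∀ y₀ ∈ A, ∃ y : ℝ → EuclideanSpace ℝ (Fin N), y t₀ = y₀ ∧
      ∀ t : ℝ, t₀ ≤ t →
        y t ∈ D ∧ HasDerivWithinAt y (F t (y t)) (Ici t₀) t ∧ ‖y t - x t‖ < η := by
    intro y₀ hy₀
    rw [hA, mem_ball, dist_eq_norm, lt_min_iff] at hy₀
    exact hstab y₀ (hclose t₀ y₀ hy₀.2).1 hy₀.1
  choose! Φ hΦ₀ hΦ using hsol
  have hvol : ∀ k : ℕ, ENNReal.ofReal (Real.exp (k * (I / 2))) * volume A ≤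
      volume (ball (x t₀) η) := by
    intro k
    set b := t₀ + k * τ with hb
    have hab : t₀ ≤ b := by rw [hb]; nlinarith [Nat.cast_nonneg (α := ℝ) k]
    have htraj : ∀ y ∈ A, IsTrajOn F D t₀ b (Φ y) := fun y hy =>
      IsTrajOn.of_hasDerivWithinAt_Ici (fun t ht => ⟨(hΦ y hy t ht).1, (hΦ y hy t ht).2.1⟩) b
    have hder : ∀ y ∈ A, ∃ M : EuclideanSpace ℝ (Fin N) →L[ℝ] EuclideanSpace ℝ (Fin N),
        HasFDerivAt (fun y => Φ y b) M y ∧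
        M.det = Real.exp (∫ t in t₀..b, traceCLM N (fderiv ℝ (F t) (Φ y t))) := fun y hy =>
      exists_hasFDerivAt_flow hD hF hab
        (Filter.eventually_of_mem (isOpen_ball.mem_nhds hy) fun w hw => ⟨hΦ₀ w hw, htraj w hw⟩)
    choose! M hM hdet using hder
    obtain ⟨K, hK⟩ := isCompact_Icc.exists_bound_of_continuousOn
      (hBc.continuousOn (s := Icc t₀ b))
    have hLip : ∀ t ∈ Icc t₀ b, LipschitzOnWith (K + κ).toNNReal (F t) (ball (x t) η) := by
      intro t ht
      refine (convex_ball _ _).lipschitzOnWith_of_nnnorm_hasFDerivWithin_le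
        (f' := fderiv ℝ (F t)) (fun z hz => ?_) (fun z hz => ?_)
      · rw [mem_ball, dist_eq_norm] at hz
        exact (hasFDerivAt_slice hD hF (hclose t z hz).1 t).differentiableAt.hasFDerivAt.hasFDerivWithinAt
      · rw [mem_ball, dist_eq_norm] at hz
        rw [← norm_toNNReal]
        refine Real.toNNReal_le_toNNReal ?_
        have h1 := norm_add_le (fderiv ℝ (F t) (x t)) (fderiv ℝ (F t) z - fderiv ℝ (F t) (x t))
        rw [add_sub_cancel] at h1
        linarith [hK t ht, (hclose t z hz).2]
    have hinj : InjOn (fun y => Φ y b) A := by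
      intro y hy z hz hyz
      rw [← hΦ₀ y hy, ← hΦ₀ z hz]
      exact eq_of_eq_right_of_hasDerivWithinAt_Ici hab hLip
        (fun t ht => ⟨by rw [mem_ball, dist_eq_norm]; exact (hΦ y hy t ht).2.2,
          (hΦ y hy t ht).2.1⟩)
        (fun t ht => ⟨by rw [mem_ball, dist_eq_norm]; exact (hΦ z hz t ht).2.2,
          (hΦ z hz t ht).2.1⟩) hyz
    have hdet_le : ∀ y ∈ A, Real.exp (k * (I / 2)) ≤ |(M y).det| := by
      intro y hy
      rw [hdet y hy, abs_of_pos (Real.exp_pos _), Real.exp_le_exp]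
      have hper_g : Function.Periodic (fun t => traceCLM N (fderiv ℝ (F t) (x t))) τ := by
        intro t
        simp only [hxper t, fderiv_add_period hD hper (hxD t) t]
      have hkI : ∫ t in t₀..b, traceCLM N (fderiv ℝ (F t) (x t)) = k * I := by
        have := hper_g.intervalIntegral_add_zsmul_eq k t₀ (fun a b => hgc.intervalIntegrable a b)
        simpa [hb, hIdef] using this
      have hΦc : ContinuousOn (fun t => traceCLM N (fderiv ℝ (F t) (Φ y t))) (Icc t₀ b) :=
        (traceCLM N).continuous.comp_continuousOn ((continuousOn_fderiv_slice hD hF).comp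
          ((htraj y hy).continuousOn.prodMk continuousOn_id)
          fun t ht => ⟨(htraj y hy).mem t ht, mem_univ _⟩)
      calc (k : ℝ) * (I / 2)
          = ∫ t in t₀..b, (traceCLM N (fderiv ℝ (F t) (x t)) - I / (2 * τ)) := by
            rw [intervalIntegral.integral_sub (hgc.intervalIntegrable _ _)
              intervalIntegrable_const, hkI, intervalIntegral.integral_const, smul_eq_mul, hb]
            field_simp
            ring
        _ ≤ ∫ t in t₀..b, traceCLM N (fderiv ℝ (F t) (Φ y t)) := by
            refine intervalIntegral.integral_mono_on hab
              ((hgc.intervalIntegrable _ _).sub intervalIntegrable_const)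
              (ContinuousOn.intervalIntegrable (by rwa [uIcc_of_le hab])) fun t ht => ?_
            exact htr t _ (hΦ y hy t ht.1).2.2
    calc ENNReal.ofReal (Real.exp (k * (I / 2))) * volume A
        = ∫⁻ _ in A, ENNReal.ofReal (Real.exp (k * (I / 2))) := by
          rw [setLIntegral_const]
      _ ≤ ∫⁻ y in A, ENNReal.ofReal |(M y).det| :=
          setLIntegral_mono' measurableSet_ball fun y hy => ENNReal.ofReal_le_ofReal (hdet_le y hy)
      _ = volume ((fun y => Φ y b) '' A) :=
          lintegral_abs_det_fderiv_eq_addHaar_image volume measurableSet_ball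
            (fun y hy => (hM y hy).hasFDerivWithinAt) hinj
      _ ≤ volume (ball (x t₀) η) := by
          refine measure_mono ?_
          rintro _ ⟨y, hy, rfl⟩
          -- As `b - t₀` is a multiple of the period, the images for all `k` land in one and the
          -- same ball.
          have hxb : x b = x t₀ := by
            have := hxper.nat_mul k t₀
            rwa [hb]
          rw [mem_ball, dist_eq_norm, ← hxb]
          exact (hΦ y hy b hab).2.2
  have hA0 : 0 < (volume A).toReal := ENNReal.toReal_pos
    (measure_ball_pos volume _ (lt_min hρ hη)).ne' measure_ball_lt_top.ne
  -- The linear lower bound `s + 1 ≤ exp s` already outgrows the fixed volume.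
  obtain ⟨k, hk⟩ := exists_nat_gt ((volume (ball (x t₀) η)).toReal / (I / 2 * (volume A).toReal))
  have h1 := ENNReal.toReal_mono measure_ball_lt_top.ne (hvol k)
  rw [ENNReal.toReal_mul, ENNReal.toReal_ofReal (Real.exp_pos _).le] at h1
  rw [div_lt_iff₀ (by positivity)] at hk
  have h2 := mul_le_mul_of_nonneg_right (Real.add_one_le_exp (k * (I / 2))) hA0.le
  linarith

end Instability

/-! ### Vanishing mean divergence for a `C¹` period function -/

section PeriodFunction

open Filter Topology Metric MeasureTheory

variable {N : ℕ} {D : Set (EuclideanSpace ℝ (Fin N))}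

theorem IsSolution.isTrajOn {F : ℝ → EuclideanSpace ℝ (Fin N) → EuclideanSpace ℝ (Fin N)}
    {y : ℝ → EuclideanSpace ℝ (Fin N)} (h : IsSolution D F y) (a b : ℝ) : IsTrajOn F D a b y :=
  ⟨fun t _ => (h t).2.continuousAt.continuousWithinAt, fun t _ => (h t).1,
    fun t _ => (h t).2.hasDerivWithinAt⟩

variable {f₀ : EuclideanSpace ℝ (Fin N) → EuclideanSpace ℝ (Fin N)}

theorem IsSolution.comp_sub_const {y : ℝ → EuclideanSpace ℝ (Fin N)}
    (h : IsSolution D (fun _ => f₀) y) (c : ℝ) :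
    IsSolution D (fun _ => f₀) (fun t => y (t - c)) :=
  fun t => ⟨(h _).1, (h (t - c)).2.comp_sub_const t c⟩

theorem IsSolution.comp_neg {y : ℝ → EuclideanSpace ℝ (Fin N)}
    (h : IsSolution D (fun _ => f₀) y) :
    IsSolution D (fun _ => -f₀) (fun t => y (-t)) :=
  fun t => ⟨(h _).1, by
    have h1 : HasDerivAt (fun t => y (-t)) _ t :=
      HasDerivAt.scomp (g₁ := y) (h := fun t => -t) t (h (-t)).2 (hasDerivAt_neg t)
    exact h1.congr_deriv (by simp)⟩

/-- Lipschitz dependence on initial values, applied with initial distance zero. -/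
theorem IsSolution.eq_of_le (hD : IsOpen D) (hf₀ : ContDiffOn ℝ 1 f₀ D)
    {x y : ℝ → EuclideanSpace ℝ (Fin N)} (hx : IsSolution D (fun _ => f₀) x)
    (hy : IsSolution D (fun _ => f₀) y) {s : ℝ} (h : x s = y s) {t : ℝ} (hst : s ≤ t) :
    x t = y t := by
  obtain ⟨C, _, ρ, hρ, hC⟩ := exists_norm_sub_le_mul_of_isTrajOn hD hf₀ (hx.isTrajOn s t)
  have := hC y (hy.isTrajOn s t) (by simpa [h] using hρ) t ⟨hst, le_rfl⟩
  rw [h, sub_self, norm_zero, mul_zero, norm_le_zero_iff, sub_eq_zero] at this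
  exact this.symm

/-- Uniqueness of global solutions of an autonomous equation. -/
theorem IsSolution.eq_of_eq (hD : IsOpen D) (hf₀ : ContDiffOn ℝ 1 f₀ D)
    {x y : ℝ → EuclideanSpace ℝ (Fin N)} (hx : IsSolution D (fun _ => f₀) x)
    (hy : IsSolution D (fun _ => f₀) y) {s : ℝ} (h : x s = y s) : x = y := by
  funext t
  rcases le_total s t with hst | hts
  · exact hx.eq_of_le hD hf₀ hy h hst
  · have := hx.comp_neg.eq_of_le hD hf₀.neg hy.comp_neg (s := -s) (by simpa using h)
      (neg_le_neg hts)
    simpa using this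

/-- Along a solution, the period function gives the minimal period of that solution. -/
theorem IsPeriodFunction.periodic_of_isSolution (hD : IsOpen D) (hf₀ : ContDiffOn ℝ 1 f₀ D)
    {P : EuclideanSpace ℝ (Fin N) → ℝ} (hP : IsPeriodFunction D f₀ P)
    {x : ℝ → EuclideanSpace ℝ (Fin N)} (hx : IsSolution D (fun _ => f₀) x) (s : ℝ) :
    Function.Periodic x (P (x s)) ∧ ∀ r, 0 < r → r < P (x s) → ¬ Function.Periodic x r := by
  obtain ⟨_, y, hy0, hy, hper, hmin⟩ := hP.2 (x s) (hx s).1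
  have hxy : ∀ t, x t = y (t - s) :=
    congrFun (hx.eq_of_eq hD hf₀ (hy.comp_sub_const s) (s := s) (by simp [hy0]))
  refine ⟨fun t => ?_, fun r hr hrP hxr => hmin r hr hrP fun t => ?_⟩
  · rw [hxy, hxy t, ← sub_add_eq_add_sub, hper]
  · have := hxr (t + s)
    rwa [hxy, hxy (t + s), add_sub_cancel_right, add_right_comm, add_sub_cancel_right] at this

/-- Both values are the minimal period of the same solution, so neither can be smaller. -/
theorem IsPeriodFunction.eq_along_solution (hD : IsOpen D) (hf₀ : ContDiffOn ℝ 1 f₀ D)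
    {P : EuclideanSpace ℝ (Fin N) → ℝ} (hP : IsPeriodFunction D f₀ P)
    {x : ℝ → EuclideanSpace ℝ (Fin N)} (hx : IsSolution D (fun _ => f₀) x) (s t : ℝ) :
    P (x s) = P (x t) := by
  have hs := hP.periodic_of_isSolution hD hf₀ hx s
  have ht := hP.periodic_of_isSolution hD hf₀ hx t
  refine le_antisymm ?_ ?_
  · by_contra! h
    exact hs.2 _ (hP.2 _ (hx t).1).1 h ht.1
  · by_contra! h
    exact ht.2 _ (hP.2 _ (hx s).1).1 h hs.1

/-- If all orbits are periodic with a `C¹` period, then the mean divergence along each orbit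
vanishes: the derivative of the flow at time a multiple `Q` of the period is
`v ↦ v - dQ(v) f₀(p)`, which has determinant `1`. -/
theorem IsPeriodFunction.integral_trace_eq_zero (hD : IsOpen D) (hf₀ : ContDiffOn ℝ 1 f₀ D)
    {P : EuclideanSpace ℝ (Fin N) → ℝ} (hP : IsPeriodFunction D f₀ P)
    {x : ℝ → EuclideanSpace ℝ (Fin N)} (hx : IsSolution D (fun _ => f₀) x)
    (t₀ : ℝ) {m : ℕ} (hm : 0 < m) :
    ∫ t in t₀..(t₀ + m * P (x t₀)), traceCLM N (fderiv ℝ f₀ (x t)) = 0 := by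
  set p := x t₀ with hp
  have hpD : p ∈ D := (hx t₀).1
  set Q : EuclideanSpace ℝ (Fin N) → ℝ := fun y => m * P y with hQ
  have hQ0 : 0 < Q p := mul_pos (Nat.cast_pos.2 hm) (hP.2 p hpD).1
  set b := t₀ + Q p with hb
  have hsol : ∀ y ∈ D, ∃ φ : ℝ → EuclideanSpace ℝ (Fin N), φ t₀ = y ∧
      IsSolution D (fun _ => f₀) φ ∧ Function.Periodic φ (Q y) := by
    intro y hy
    obtain ⟨_, φ, hφ0, hφ, hper, _⟩ := hP.2 y hy
    exact ⟨fun t => φ (t - t₀), by simpa using hφ0, hφ.comp_sub_const t₀, fun t => by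
      have := hper.nat_mul m (t - t₀)
      simpa [hQ, sub_add_eq_add_sub] using this⟩
  choose! Φ hΦ₀ hΦ hΦper using hsol
  have hΦp : Φ p = x := (hΦ p hpD).eq_of_eq hD hf₀ hx (s := t₀) (hΦ₀ p hpD)
  have hev : ∀ b, ∀ᶠ y in 𝓝 p, Φ y t₀ = y ∧ IsTrajOn (fun _ => f₀) D t₀ b (Φ y) := fun b =>
    Filter.eventually_of_mem (hD.mem_nhds hpD) fun y hy => ⟨hΦ₀ y hy, (hΦ y hy).isTrajOn _ _⟩
  have hF : ContDiffOn ℝ 1 (fun q : EuclideanSpace ℝ (Fin N) × ℝ => f₀ q.1) (D ×ˢ univ) :=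
    hf₀.comp contDiffOn_fst fun q hq => hq.1
  obtain ⟨M, hM, hdet⟩ := exists_hasFDerivAt_flow (F := fun _ => f₀) hD hF
    (show t₀ ≤ b by linarith) (hev b)
  -- The return time `t₀ + Q y` may exceed `b`, hence the margin `b + 1`; below, `r ≤ 1` and `r ≤ Q
  -- p` keep the ball around `b` inside `[t₀, b + 1]`.
  obtain ⟨C, hC, hlip⟩ := exists_eventually_norm_flow_sub_le (F := fun _ => f₀) hD hF (hev (b + 1))
  have hdQ : HasFDerivAt Q (fderiv ℝ Q p) p :=
    (((hP.1.differentiableOn one_ne_zero).differentiableAt (hD.mem_nhds hpD)).const_mul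
      _).hasFDerivAt
  have hxb : x b = p := by
    have := hΦper p hpD t₀
    rwa [hΦp] at this
  -- The orbit of `y` is back at `y` at time `t₀ + Q y`; between that time and `b` its velocity is
  -- within `κ` of `f₀ p`, so it moves by nearly `-(Q y - Q p) • f₀ p`.
  have hrem : (fun y => Φ y b - y + (Q y - Q p) • f₀ p) =o[𝓝 p] fun y => Q y - Q p := by
    rw [Asymptotics.isLittleO_iff]
    intro κ hκ
    obtain ⟨δ₁, hδ₁, hf⟩ := Metric.continuousAt_iff.1
      (hf₀.continuousOn.continuousAt (hD.mem_nhds hpD)) κ hκ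
    obtain ⟨δ₂, hδ₂, hxδ⟩ := Metric.continuousAt_iff.1 (hx b).2.continuousAt (δ₁ / 2) (by positivity)
    have h1 : ∀ᶠ y in 𝓝 p, C * ‖y - p‖ < δ₁ / 2 := by
      have : ContinuousAt (fun y => C * ‖y - p‖) p := by fun_prop
      exact this.eventually_lt continuousAt_const (by simpa using half_pos hδ₁)
    have h2 : ∀ᶠ y in 𝓝 p, |Q y - Q p| < min δ₂ (min 1 (Q p)) := by
      have : ContinuousAt (fun y => |Q y - Q p|) p :=
        (hdQ.continuousAt.sub continuousAt_const).abs
      exact this.eventually_lt continuousAt_const (by simp [hδ₂, hQ0])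
    filter_upwards [h1, h2, hlip, hD.mem_nhds hpD] with y hy1 hy2 hy3 hyD
    set r := min δ₂ (min 1 (Q p)) with hr
    have hr0 : 0 < r := by positivity
    have hmv := (convex_ball b r).norm_image_sub_le_of_norm_hasDerivWithin_le
      (f := fun t => Φ y t - t • f₀ p) (f' := fun t => f₀ (Φ y t) - f₀ p) (C := κ)
      (x := t₀ + Q y) (y := b)
      (fun t _ => (((hΦ y hyD t).2.sub (by
        simpa using (hasDerivAt_id t).smul_const (f₀ p)))).hasDerivWithinAt)
      (fun t ht => by
        rw [mem_ball, Real.dist_eq] at ht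
        have hlt := abs_lt.1 ht
        have hr1 : r ≤ 1 := (min_le_right _ _).trans (min_le_left _ _)
        have hr2 : r ≤ Q p := (min_le_right _ _).trans (min_le_right _ _)
        have h3 := hy3 t ⟨by linarith, by linarith⟩
        have h4 := hxδ (x := t) (by rw [Real.dist_eq]; exact ht.trans_le (min_le_left _ _))
        rw [hΦp] at h3
        rw [hxb, dist_eq_norm] at h4
        have h5 := norm_add_le (Φ y t - x t) (x t - p)
        rw [sub_add_sub_cancel] at h5
        have h6 := hf (x := Φ y t) (by rw [dist_eq_norm]; linarith)
        rw [dist_eq_norm] at h6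
        exact h6.le)
      (by rw [mem_ball, Real.dist_eq, hb, add_sub_add_left_eq_sub]; exact hy2)
      (mem_ball_self hr0)
    have hret : Φ y (t₀ + Q y) = y := by rw [hΦper y hyD t₀, hΦ₀ y hyD]
    have e1 : Φ y b - b • f₀ p - (Φ y (t₀ + Q y) - (t₀ + Q y) • f₀ p) =
        Φ y b - y + (Q y - Q p) • f₀ p := by
      rw [hret, hb]; module
    have e2 : ‖b - (t₀ + Q y)‖ = ‖Q y - Q p‖ := by
      rw [hb, add_sub_add_left_eq_sub, norm_sub_rev]
    rw [e1, e2] at hmv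
    exact hmv
  have hzero : HasFDerivAt (fun y => Φ y b - y + (Q y - Q p) • f₀ p)
      (0 : EuclideanSpace ℝ (Fin N) →L[ℝ] EuclideanSpace ℝ (Fin N)) p := by
    rw [hasFDerivAt_iff_isLittleO]
    have h0 : Φ p b - p + (Q p - Q p) • f₀ p = 0 := by simp [hΦp, hxb]
    simp only [h0, sub_zero, _root_.zero_apply]
    exact hrem.trans_isBigO hdQ.isBigO_sub
  have hsum := hzero.unique
    ((hM.sub (hasFDerivAt_id p)).add ((hdQ.sub_const (Q p)).smul_const (f₀ p)))
  have hconst : fderiv ℝ Q p (f₀ p) = 0 := by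
    have h1 : HasDerivAt (fun t => Q (x t)) (fderiv ℝ Q p (f₀ p)) t₀ :=
      HasFDerivAt.comp_hasDerivAt t₀ (l := Q) hdQ (hx t₀).2
    have h2 : (fun t => Q (x t)) = fun _ => Q p := by
      funext t
      simp only [hQ]
      rw [hP.eq_along_solution hD hf₀ hx t t₀]
    rw [h2] at h1
    exact h1.unique (hasDerivAt_const _ _)
  have hMdet : M.det = 1 := by
    -- `M` is the identity plus a rank-one map whose form `-dQ` kills its vector `f₀ p`, hence a
    -- shear of determinant one.
    have hMt : (M : EuclideanSpace ℝ (Fin N) →ₗ[ℝ] EuclideanSpace ℝ (Fin N)) =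
        LinearMap.transvection (-(fderiv ℝ Q p : EuclideanSpace ℝ (Fin N) →ₗ[ℝ] ℝ)) (f₀ p) := by
      ext1 v
      have := DFunLike.congr_fun hsum v
      simp only [_root_.zero_apply, _root_.add_apply, _root_.sub_apply,
        ContinuousLinearMap.smulRight_apply, ContinuousLinearMap.id_apply] at this
      rw [LinearMap.transvection.apply, LinearMap.neg_apply, ContinuousLinearMap.coe_coe,
        ContinuousLinearMap.coe_coe, neg_smul, ← sub_eq_add_neg, ← sub_eq_zero, this]
      abel
    rw [ContinuousLinearMap.det, hMt, LinearMap.transvection.det]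
    simp [hconst]
  rw [hMdet, hΦp, eq_comm, Real.exp_eq_one_iff] at hdet
  exact hdet

end PeriodFunction

/-! ### First-order expansion in the parameter -/

section Expansion

open Filter Topology Metric MeasureTheory

variable {N : ℕ} {D : Set (EuclideanSpace ℝ (Fin N))}
  {f₀ : EuclideanSpace ℝ (Fin N) → EuclideanSpace ℝ (Fin N)}
  {f₁ : EuclideanSpace ℝ (Fin N) → ℝ → ℝ → EuclideanSpace ℝ (Fin N)} {δ : ℝ}

theorem isOpen_extendedDomain (hD : IsOpen D) :
    IsOpen (D ×ˢ ((univ : Set ℝ) ×ˢ Ioo (-δ) δ)) :=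
  hD.prod (isOpen_univ.prod isOpen_Ioo)

/-- The perturbed field, extended by trivial equations for the time and the parameter. -/
noncomputable def extendedField
    (f₀ : EuclideanSpace ℝ (Fin N) → EuclideanSpace ℝ (Fin N))
    (f₁ : EuclideanSpace ℝ (Fin N) → ℝ → ℝ → EuclideanSpace ℝ (Fin N))
    (q : EuclideanSpace ℝ (Fin N) × ℝ × ℝ) : EuclideanSpace ℝ (Fin N) × ℝ × ℝ :=
  (f₀ q.1 + q.2.2 • f₁ q.1 q.2.1 q.2.2, 1, 0)

theorem contDiffOn_extendedField (hf₀ : ContDiffOn ℝ 1 f₀ D)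
    (hf₁ : ContDiffOn ℝ 1 (fun q : EuclideanSpace ℝ (Fin N) × ℝ × ℝ => f₁ q.1 q.2.1 q.2.2)
      (D ×ˢ ((univ : Set ℝ) ×ˢ Ioo (-δ) δ))) :
    ContDiffOn ℝ 1 (extendedField f₀ f₁) (D ×ˢ ((univ : Set ℝ) ×ˢ Ioo (-δ) δ)) :=
  ((hf₀.comp contDiffOn_fst fun _ hq => hq.1).add
    ((contDiffOn_snd.comp contDiffOn_snd fun _ _ => mem_univ _).smul hf₁)).prodMk contDiffOn_const

/-- At parameter `0` the factor `ε` kills every derivative of `f₁`, so the linearized extended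
system, in a direction with parameter component `ε`, is `ε` times the equation of `x₁`. -/
theorem fderiv_extendedField_apply (hD : IsOpen D) (hδ : 0 < δ) (hf₀ : ContDiffOn ℝ 1 f₀ D)
    (hf₁ : ContDiffOn ℝ 1 (fun q : EuclideanSpace ℝ (Fin N) × ℝ × ℝ => f₁ q.1 q.2.1 q.2.2)
      (D ×ˢ ((univ : Set ℝ) ×ˢ Ioo (-δ) δ))) {z : EuclideanSpace ℝ (Fin N)} (hz : z ∈ D)
    (t : ℝ) (w : EuclideanSpace ℝ (Fin N)) (ε : ℝ) :
    fderiv ℝ (extendedField f₀ f₁) (z, t, 0) (w, 0, ε) =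
      (fderiv ℝ f₀ z w + ε • f₁ z t 0, 0, 0) := by
  have h1 : HasFDerivAt (fun q : EuclideanSpace ℝ (Fin N) × ℝ × ℝ => f₁ q.1 q.2.1 q.2.2) _
      (z, t, 0) :=
    ((hf₁.differentiableOn one_ne_zero).differentiableAt ((isOpen_extendedDomain hD).mem_nhds
      ⟨hz, mem_univ t, by simpa using hδ⟩)).hasFDerivAt
  have h0 : HasFDerivAt (fun q : EuclideanSpace ℝ (Fin N) × ℝ × ℝ => f₀ q.1) _ (z, t, (0 : ℝ)) :=
    HasFDerivAt.comp (g := f₀) (z, t, (0 : ℝ))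
      ((hf₀.differentiableOn one_ne_zero).differentiableAt (hD.mem_nhds hz)).hasFDerivAt
      hasFDerivAt_fst
  have h2 : HasFDerivAt (fun q : EuclideanSpace ℝ (Fin N) × ℝ × ℝ => q.2.2)
      ((ContinuousLinearMap.snd ℝ ℝ ℝ).comp (ContinuousLinearMap.snd ℝ _ (ℝ × ℝ)))
      (z, t, (0 : ℝ)) :=
    ((ContinuousLinearMap.snd ℝ ℝ ℝ).comp
      (ContinuousLinearMap.snd ℝ (EuclideanSpace ℝ (Fin N)) (ℝ × ℝ))).hasFDerivAt
  have h3 := (h0.add (h2.smul h1)).prodMk (hasFDerivAt_const ((1 : ℝ), (0 : ℝ)) (z, t, (0 : ℝ)))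
  have h4 : HasFDerivAt (extendedField f₀ f₁) _ (z, t, 0) := h3
  rw [h4.fderiv]
  simp [Prod.mk_zero_zero]

theorem fderiv_perturbedField (hD : IsOpen D) (hf₀ : ContDiffOn ℝ 1 f₀ D)
    (hf₁ : ContDiffOn ℝ 1 (fun q : EuclideanSpace ℝ (Fin N) × ℝ × ℝ => f₁ q.1 q.2.1 q.2.2)
      (D ×ˢ ((univ : Set ℝ) ×ˢ Ioo (-δ) δ))) {z : EuclideanSpace ℝ (Fin N)} (hz : z ∈ D)
    (t : ℝ) {ε : ℝ} (hε : ε ∈ Ioo (-δ) δ) :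
    fderiv ℝ (perturbedField f₀ f₁ ε t) z =
      fderiv ℝ f₀ z + ε • fderiv ℝ (fun z => f₁ z t ε) z := by
  have h1 : DifferentiableAt ℝ (fun z => f₁ z t ε) z :=
    (((hf₁.differentiableOn one_ne_zero).differentiableAt ((isOpen_extendedDomain hD).mem_nhds
      ⟨hz, mem_univ t, hε⟩)).comp z (f := fun z => (z, t, ε)) (by fun_prop) :)
  have h0 : DifferentiableAt ℝ f₀ z :=
    (hf₀.differentiableOn one_ne_zero).differentiableAt (hD.mem_nhds hz)
  exact (h0.hasFDerivAt.add (h1.hasFDerivAt.const_smul ε)).fderiv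

theorem continuousOn_fderiv_perturbation (hD : IsOpen D)
    (hf₁ : ContDiffOn ℝ 1 (fun q : EuclideanSpace ℝ (Fin N) × ℝ × ℝ => f₁ q.1 q.2.1 q.2.2)
      (D ×ˢ ((univ : Set ℝ) ×ˢ Ioo (-δ) δ))) :
    ContinuousOn (fun q : EuclideanSpace ℝ (Fin N) × ℝ × ℝ =>
      fderiv ℝ (fun z => f₁ z q.2.1 q.2.2) q.1) (D ×ˢ ((univ : Set ℝ) ×ˢ Ioo (-δ) δ)) := by
  have h := (hf₁.continuousOn_fderiv_of_isOpen (isOpen_extendedDomain hD) le_rfl).clm_comp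
    (continuousOn_const (c := ContinuousLinearMap.inl ℝ (EuclideanSpace ℝ (Fin N)) (ℝ × ℝ)))
  refine h.congr fun q hq => ?_
  have h1 := ((hf₁.differentiableOn one_ne_zero).differentiableAt
    ((isOpen_extendedDomain hD).mem_nhds hq)).hasFDerivAt
  exact (HasFDerivAt.comp (f := fun z => (z, q.2))
    (g := fun q : EuclideanSpace ℝ (Fin N) × ℝ × ℝ => f₁ q.1 q.2.1 q.2.2) q.1 h1
    (hasFDerivAt_prodMk_left q.1 q.2)).fderiv

theorem IsSolution.isTrajOn_extendedField {ε : ℝ} (hε : ε ∈ Ioo (-δ) δ)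
    {y : ℝ → EuclideanSpace ℝ (Fin N)} (hy : IsSolution D (perturbedField f₀ f₁ ε) y) (a b : ℝ) :
    IsTrajOn (fun _ => extendedField f₀ f₁) (D ×ˢ ((univ : Set ℝ) ×ˢ Ioo (-δ) δ)) a b
      (fun t => (y t, t, ε)) :=
  ⟨(hy.isTrajOn a b).continuousOn.prodMk (continuousOn_id.prodMk continuousOn_const),
    fun t _ => ⟨(hy t).1, mem_univ _, hε⟩, fun t _ => (hy t).2.hasDerivWithinAt.prodMk
      ((hasDerivWithinAt_id t _).prodMk (hasDerivWithinAt_const t _ ε))⟩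

variable {S : Set ℝ} {x : ℝ → ℝ → EuclideanSpace ℝ (Fin N)} {x₁ : ℝ → EuclideanSpace ℝ (Fin N)}
  {a : ℝ}

/-- First order expansion in the parameter of a branch of solutions, uniformly on compact time
intervals. -/
theorem exists_norm_branch_sub_le (hD : IsOpen D) (hδ : 0 < δ) (hf₀ : ContDiffOn ℝ 1 f₀ D)
    (hf₁ : ContDiffOn ℝ 1 (fun q : EuclideanSpace ℝ (Fin N) × ℝ × ℝ => f₁ q.1 q.2.1 q.2.2)
      (D ×ˢ ((univ : Set ℝ) ×ˢ Ioo (-δ) δ)))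
    (hS : S ⊆ Ioo (-δ) δ) (hS0 : (0 : ℝ) ∈ S)
    (hx : ∀ ε ∈ S, IsSolution D (perturbedField f₀ f₁ ε) (x ε))
    (hx₁0 : HasDerivWithinAt (fun ε => x ε a) (x₁ a) S 0)
    (hx₁ : ∀ t : ℝ, HasDerivAt x₁ (fderiv ℝ f₀ (x 0 t) (x₁ t) + f₁ (x 0 t) t 0) t)
    (b : ℝ) {κ : ℝ} (hκ : 0 < κ) :
    ∃ ε₁ > 0, ∀ ε ∈ S, |ε| < ε₁ → ∀ t ∈ Icc a b, ‖x ε t - x 0 t - ε • x₁ t‖ ≤ κ * |ε| := by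
  obtain ⟨C, hC, h⟩ := exists_norm_sub_sub_le_of_isTrajOn (isOpen_extendedDomain hD)
    (contDiffOn_extendedField hf₀ hf₁) ((hx 0 hS0).isTrajOn_extendedField (hS hS0) a b)
  set K := ‖x₁ a‖ + 1 with hK
  have hK0 : 0 < K := by positivity
  -- Half of `κ` pays for the flow's linearization error, the initial displacement being at most `(K
  -- + 1) * |ε|`; the other half, `κ / (2 * C)` before propagation, pays for the initial error.
  obtain ⟨ρ, hρ, h⟩ := h (κ / (2 * (K + 1))) (by positivity)
  have hd := (hasDerivWithinAt_iff_isLittleO.1 hx₁0).def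
    (show 0 < min 1 (κ / (2 * C)) by positivity)
  obtain ⟨r, hr, hd⟩ := Metric.eventually_nhds_iff.1 (eventually_nhdsWithin_iff.1 hd)
  refine ⟨min r (ρ / (K + 1)), by positivity, fun ε hε hε₁ t ht => ?_⟩
  have hd1 := hd (y := ε) (by simpa using hε₁.trans_le (min_le_left _ _)) hε
  simp only [sub_zero, Real.norm_eq_abs] at hd1
  have hd2 : ‖x ε a - x 0 a‖ ≤ K * |ε| := by
    have h1 := norm_add_le (x ε a - x 0 a - ε • x₁ a) (ε • x₁ a)
    rw [sub_add_cancel, norm_smul, Real.norm_eq_abs] at h1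
    have h2 : min 1 (κ / (2 * C)) * |ε| ≤ 1 * |ε| := by gcongr; exact min_le_left _ _
    rw [hK]; linarith
  have hY : ‖((x ε a, a, ε) : EuclideanSpace ℝ (Fin N) × ℝ × ℝ) - (x 0 a, a, 0)‖ ≤
      (K + 1) * |ε| := by
    simp only [Prod.mk_sub_mk, sub_self, sub_zero, Prod.norm_mk, norm_zero, Real.norm_eq_abs]
    refine max_le ?_ (max_le (by positivity) ?_)
    · linarith [abs_nonneg ε]
    · nlinarith [abs_nonneg ε]
  have hYZ : ‖((x ε a, a, ε) : EuclideanSpace ℝ (Fin N) × ℝ × ℝ) - (x 0 a, a, 0) -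
      ((ε • x₁ a, 0, ε) : EuclideanSpace ℝ (Fin N) × ℝ × ℝ)‖ ≤ κ / (2 * C) * |ε| := by
    simp only [Prod.mk_sub_mk, sub_self, sub_zero, Prod.norm_mk, norm_zero]
    have h1 : 0 ≤ κ / (2 * C) * |ε| := by positivity
    refine max_le (hd1.trans ?_) h1
    gcongr
    exact min_le_right _ _
  have hε2 : (K + 1) * |ε| < ρ := by
    have := hε₁.trans_le (min_le_right _ _)
    rw [lt_div_iff₀ (by positivity)] at this
    linarith
  have hZ : IsTrajOn (fun t w => fderiv ℝ (extendedField f₀ f₁) (x 0 t, t, 0) w) univ a b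
      (fun t => (ε • x₁ t, 0, ε)) := by
    have hx₁c : Continuous x₁ := continuous_iff_continuousAt.2 fun t => (hx₁ t).continuousAt
    refine ⟨by fun_prop, fun _ _ => mem_univ _, fun t _ => ?_⟩
    rw [fderiv_extendedField_apply hD hδ hf₀ hf₁ ((hx 0 hS0) t).1, map_smul, ← smul_add]
    exact ((hx₁ t).fun_const_smul ε).hasDerivWithinAt.prodMk
      (hasDerivWithinAt_const t _ ((0 : ℝ), ε))
  have hfin := h _ ((hx ε hε).isTrajOn_extendedField (hS hε) a b) (hY.trans_lt hε2) _ hZ t ht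
  calc ‖x ε t - x 0 t - ε • x₁ t‖
      ≤ ‖((x ε t, t, ε) : EuclideanSpace ℝ (Fin N) × ℝ × ℝ) - (x 0 t, t, 0) -
          (ε • x₁ t, 0, ε)‖ := by
        simp only [Prod.mk_sub_mk]
        exact le_max_left _ _
    _ ≤ _ := hfin
    _ ≤ C * (κ / (2 * C) * |ε|) + κ / (2 * (K + 1)) * ((K + 1) * |ε|) := by gcongr
    _ = κ * |ε| := by field_simp; ring

/-- The linearization along a branch of solutions agrees with `linearizationA` to first order in
the parameter. -/
theorem exists_norm_fderiv_sub_linearizationA_le (hD : IsOpen D) (hδ : 0 < δ)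
    (hf₀ : ContDiffOn ℝ 2 f₀ D)
    (hf₁ : ContDiffOn ℝ 1 (fun q : EuclideanSpace ℝ (Fin N) × ℝ × ℝ => f₁ q.1 q.2.1 q.2.2)
      (D ×ˢ ((univ : Set ℝ) ×ˢ Ioo (-δ) δ)))
    (hS : S ⊆ Ioo (-δ) δ) (hS0 : (0 : ℝ) ∈ S)
    (hx : ∀ ε ∈ S, IsSolution D (perturbedField f₀ f₁ ε) (x ε))
    (hx₁0 : HasDerivWithinAt (fun ε => x ε a) (x₁ a) S 0)
    (hx₁ : ∀ t : ℝ, HasDerivAt x₁ (fderiv ℝ f₀ (x 0 t) (x₁ t) + f₁ (x 0 t) t 0) t)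
    (b : ℝ) {κ : ℝ} (hκ : 0 < κ) :
    ∃ ε₁ > 0, ∀ ε ∈ S, |ε| < ε₁ → ∀ t ∈ Icc a b,
      ‖fderiv ℝ (perturbedField f₀ f₁ ε t) (x ε t) - linearizationA f₀ f₁ (x 0) x₁ t ε‖
        ≤ κ * |ε| := by
  have hf₀' : ContDiffOn ℝ 1 f₀ D := hf₀.of_le one_le_two
  have hdf₀ : ContDiffOn ℝ 1 (fderiv ℝ f₀) D :=
    hf₀.fderiv_of_isOpen hD (by norm_num)
  have hx0c : Continuous (x 0) :=
    continuous_iff_continuousAt.2 fun t => (hx 0 hS0 t).2.continuousAt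
  have hx₁c : Continuous x₁ := continuous_iff_continuousAt.2 fun t => (hx₁ t).continuousAt
  have hx0D : ∀ t, x 0 t ∈ D := fun t => (hx 0 hS0 t).1
  obtain ⟨K₁, hK₁⟩ := isCompact_Icc.exists_bound_of_continuousOn (hx₁c.continuousOn (s := Icc a b))
  have himg : IsCompact (x 0 '' Icc a b) := isCompact_Icc.image hx0c
  have himgD : x 0 '' Icc a b ⊆ D := image_subset_iff.2 fun t _ => hx0D t
  obtain ⟨L₂, hL₂, hK₂⟩ := exists_forall_norm_fderiv_le_of_isCompact hD hdf₀ himg himgD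
  set L₁ := |K₁| + 1 with hL₁
  have hL₁0 : L₁ ≠ 0 := by positivity
  obtain ⟨r₀, hr₀, hU₀⟩ := exists_forall_norm_sub_sub_fderiv_le_of_isCompact hD hdf₀ himg himgD
    (show 0 < κ / (3 * L₁) by positivity)
  obtain ⟨r₁, hr₁, hU₁⟩ := exists_forall_norm_sub_lt_of_isCompact (isOpen_extendedDomain hD)
    (continuousOn_fderiv_perturbation hD hf₁)
    (isCompact_Icc.image (by fun_prop) :
      IsCompact ((fun t => (x 0 t, t, (0 : ℝ))) '' Icc a b))
    (by rintro _ ⟨t, _, rfl⟩; exact ⟨hx0D t, mem_univ _, hS hS0⟩)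
    (show 0 < κ / 3 by positivity)
  obtain ⟨ε₁, hε₁, hE⟩ := exists_norm_branch_sub_le hD hδ hf₀' hf₁ hS hS0 hx hx₁0 hx₁ b
    (show 0 < min 1 (κ / (3 * L₂)) by positivity)
  refine ⟨min ε₁ (min (r₀ / L₁) (min (r₁ / L₁) r₁)), by positivity, fun ε hε hlt t ht => ?_⟩
  simp only [lt_min_iff] at hlt
  obtain ⟨hlt1, hlt2, hlt3, hlt4⟩ := hlt
  rw [lt_div_iff₀ (by positivity)] at hlt2 hlt3
  have h1 := hE ε hε hlt1 t ht
  have hdist : ‖x ε t - x 0 t‖ ≤ L₁ * |ε| := by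
    have h2 := norm_add_le (x ε t - x 0 t - ε • x₁ t) (ε • x₁ t)
    rw [sub_add_cancel, norm_smul, Real.norm_eq_abs] at h2
    have h3 : min 1 (κ / (3 * L₂)) * |ε| ≤ 1 * |ε| := by gcongr; exact min_le_left _ _
    have h4 : |ε| * ‖x₁ t‖ ≤ |ε| * |K₁| := by gcongr; exact (hK₁ t ht).trans (le_abs_self _)
    rw [hL₁]; linarith
  have hA := (hU₀ (x 0 t) ⟨t, ht, rfl⟩ (x ε t) (hdist.trans_lt (by linarith))).2
  have hA' : ‖fderiv ℝ f₀ (x ε t) - fderiv ℝ f₀ (x 0 t) -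
      fderiv ℝ (fderiv ℝ f₀) (x 0 t) (x ε t - x 0 t)‖ ≤ κ / 3 * |ε| := by
    refine hA.trans ?_
    calc κ / (3 * L₁) * ‖x ε t - x 0 t‖ ≤ κ / (3 * L₁) * (L₁ * |ε|) := by gcongr
      _ = κ / 3 * |ε| := by field_simp
  have hB : ‖fderiv ℝ (fderiv ℝ f₀) (x 0 t) (x ε t - x 0 t - ε • x₁ t)‖ ≤ κ / 3 * |ε| := by
    calc _ ≤ L₂ * (min 1 (κ / (3 * L₂)) * |ε|) := by
          exact (ContinuousLinearMap.le_of_opNorm_le _ (hK₂ _ ⟨t, ht, rfl⟩) _).trans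
            (mul_le_mul_of_nonneg_left h1 (by positivity))
      _ ≤ L₂ * (κ / (3 * L₂) * |ε|) := by gcongr; exact min_le_right _ _
      _ = κ / 3 * |ε| := by field_simp
  have hC : ‖ε • (fderiv ℝ (fun z => f₁ z t ε) (x ε t) - fderiv ℝ (fun z => f₁ z t 0) (x 0 t))‖ ≤
      κ / 3 * |ε| := by
    have h5 := (hU₁ (x 0 t, t, 0) ⟨t, ht, rfl⟩ (x ε t, t, ε) (by
      simp only [Prod.mk_sub_mk, sub_self, sub_zero, Prod.norm_mk, norm_zero, Real.norm_eq_abs]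
      exact max_lt (hdist.trans_lt (by linarith)) (max_lt hr₁ hlt4))).2
    rw [norm_smul, Real.norm_eq_abs, mul_comm]
    gcongr
  rw [fderiv_perturbedField hD hf₀' hf₁ ((hx ε hε) t).1 t (hS hε)]
  -- Three errors, each at most `κ / 3 * |ε|`: the Taylor remainder of `fderiv ℝ f₀`, the error in
  -- the expansion of the branch, and the variation of `∂f₁/∂x`. The last already carries a factor
  -- `ε`, so continuity of that derivative is enough.
  have hdecomp : fderiv ℝ f₀ (x ε t) + ε • fderiv ℝ (fun z => f₁ z t ε) (x ε t) -
      linearizationA f₀ f₁ (x 0) x₁ t ε =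
      (fderiv ℝ f₀ (x ε t) - fderiv ℝ f₀ (x 0 t) -
        fderiv ℝ (fderiv ℝ f₀) (x 0 t) (x ε t - x 0 t)) +
      fderiv ℝ (fderiv ℝ f₀) (x 0 t) (x ε t - x 0 t - ε • x₁ t) +
      ε • (fderiv ℝ (fun z => f₁ z t ε) (x ε t) - fderiv ℝ (fun z => f₁ z t 0) (x 0 t)) := by
    rw [linearizationA, map_sub (fderiv ℝ (fderiv ℝ f₀) (x 0 t)) (x ε t - x 0 t), map_smul]
    module
  rw [hdecomp]
  refine (norm_add₃_le).trans ?_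
  linarith

end Expansion

/-! ### Instability of the branch -/

theorem corollary1 {N : ℕ}
    -- the perturbed system `x' = f₀ x + ε f₁(x, t; ε)` on the open set `D`
    (D : Set (EuclideanSpace ℝ (Fin N))) (hD : IsOpen D)
    (f₀ : EuclideanSpace ℝ (Fin N) → EuclideanSpace ℝ (Fin N))
    (hf₀ : ContDiffOn ℝ 2 f₀ D)
    (δ : ℝ) (hδ : 0 < δ)
    (f₁ : EuclideanSpace ℝ (Fin N) → ℝ → ℝ → EuclideanSpace ℝ (Fin N))
    (hf₁ : ContDiffOn ℝ 2
      (fun q : EuclideanSpace ℝ (Fin N) × ℝ × ℝ => f₁ q.1 q.2.1 q.2.2)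
      (D ×ˢ ((univ : Set ℝ) ×ˢ Ioo (-δ) δ)))
    (T : ℝ) (hT : 0 < T)
    (hper : ∀ z ∈ D, ∀ t : ℝ, ∀ ε ∈ Ioo (-δ) δ, f₁ z (t + T) ε = f₁ z t ε)
    -- the unperturbed system has only periodic orbits in `D`, with `C¹` period function
    (P : EuclideanSpace ℝ (Fin N) → ℝ) (hP : IsPeriodFunction D f₀ P)
    -- a branch `x ε`, `ε ∈ S`, of `nT`-periodic solutions, with `x 0` a resonant unperturbed orbit
    (t₀ : ℝ) (m n : ℕ) (hm : 0 < m) (hn : 0 < n)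
    (S : Set ℝ) (hS : S ⊆ Ioo (-δ) δ) (hS0 : (0 : ℝ) ∈ S)
    (x : ℝ → ℝ → EuclideanSpace ℝ (Fin N))
    (hx : ∀ ε ∈ S, IsSolution D (perturbedField f₀ f₁ ε) (x ε) ∧
      Function.Periodic (x ε) ((n : ℝ) * T))
    (hres : (m : ℝ) * P (x 0 t₀) = (n : ℝ) * T)
    -- `x₁` is the first order term of the branch in `ε`: the solution of the variational
    -- equation whose initial value is the derivative of the initial condition of the branch
    (x₁ : ℝ → EuclideanSpace ℝ (Fin N))
    (hx₁0 : HasDerivWithinAt (fun ε => x ε t₀) (x₁ t₀) S 0)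
    (hx₁ : ∀ t : ℝ, HasDerivAt x₁ (fderiv ℝ f₀ (x 0 t) (x₁ t) + f₁ (x 0 t) t 0) t) :
    ∃ ε₀ : ℝ, 0 < ε₀ ∧ ∀ ε ∈ S, 0 < |ε| → |ε| < ε₀ →
      0 < meanTrace f₀ f₁ (x 0) x₁ t₀ T n ε →
        IsUnstable D (perturbedField f₀ f₁ ε) t₀ (x ε) := by
  have hf₀' : ContDiffOn ℝ 1 f₀ D := hf₀.of_le one_le_two
  have hf₁' := hf₁.of_le (m := 1) one_le_two
  have hdf₀ : ContDiffOn ℝ 1 (fderiv ℝ f₀) D := hf₀.fderiv_of_isOpen hD (by norm_num)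
  have hnT : 0 < (n : ℝ) * T := mul_pos (Nat.cast_pos.2 hn) hT
  have hx0 : IsSolution D (fun _ => f₀) (x 0) := fun t => by
    simpa [perturbedField] using (hx 0 hS0).1 t
  have hx0c : Continuous (x 0) := continuous_iff_continuousAt.2 fun t => (hx0 t).2.continuousAt
  have hx₁c : Continuous x₁ := continuous_iff_continuousAt.2 fun t => (hx₁ t).continuousAt
  set b := t₀ + (n : ℝ) * T with hb
  have hab : t₀ ≤ b := by linarith
  set g₀ : ℝ → ℝ := fun t => traceCLM N (fderiv ℝ f₀ (x 0 t)) with hg₀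
  set g₁ : ℝ → ℝ := fun t => traceCLM N
    (fderiv ℝ (fun z => f₁ z t 0) (x 0 t) + fderiv ℝ (fderiv ℝ f₀) (x 0 t) (x₁ t)) with hg₁
  have hg₀c : Continuous g₀ := (traceCLM N).continuous.comp <| continuousOn_univ.1 <|
    (hf₀'.continuousOn_fderiv_of_isOpen hD le_rfl).comp hx0c.continuousOn fun t _ => (hx0 t).1
  have hg₁c : Continuous g₁ := by
    have h1 : Continuous fun t => fderiv ℝ (fun z => f₁ z t 0) (x 0 t) := continuousOn_univ.1 <|
      (continuousOn_fderiv_perturbation hD hf₁').comp (f := fun t => (x 0 t, t, (0 : ℝ)))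
        (by fun_prop) fun t _ => ⟨(hx0 t).1, mem_univ _, hS hS0⟩
    have h2 : Continuous fun t => fderiv ℝ (fderiv ℝ f₀) (x 0 t) := continuousOn_univ.1 <|
      (hdf₀.continuousOn_fderiv_of_isOpen hD le_rfl).comp hx0c.continuousOn fun t _ => (hx0 t).1
    exact (traceCLM N).continuous.comp (h1.add (h2.clm_apply hx₁c))
  have htrA : ∀ t ε, traceCLM N (linearizationA f₀ f₁ (x 0) x₁ t ε) = g₀ t + ε * g₁ t := by
    intro t ε
    rw [linearizationA, map_add, map_smul, smul_eq_mul]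
  -- Resonance turns the interval of length `n T` into `m` periods of the unperturbed orbit.
  have hg₀int : ∫ t in t₀..b, g₀ t = 0 := by
    have := hP.integral_trace_eq_zero hD hf₀' hx0 t₀ hm
    rwa [hres] at this
  set c := ∫ t in t₀..b, g₁ t with hc
  have hAint : ∀ ε, ∫ t in t₀..b, (g₀ t + ε * g₁ t) = ε * c := by
    intro ε
    rw [intervalIntegral.integral_add (hg₀c.intervalIntegrable _ _)
      ((hg₁c.const_mul ε).intervalIntegrable _ _), hg₀int, zero_add,
      intervalIntegral.integral_const_mul]
  have hmean : ∀ ε, meanTrace f₀ f₁ (x 0) x₁ t₀ T n ε = 1 / ((n : ℝ) * T) * (ε * c) := by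
    intro ε
    rw [← hAint, meanTrace]
    congr 1
    exact intervalIntegral.integral_congr fun t _ => htrA t ε
  -- If `c = 0`, the mean trace vanishes for every `ε` and the claim is vacuous.
  rcases eq_or_ne c 0 with hc0 | hc0
  · refine ⟨1, one_pos, fun ε _ _ _ hpos => ?_⟩
    rw [hmean, hc0, mul_zero, mul_zero] at hpos
    exact absurd hpos (lt_irrefl _)
  set L := ‖traceCLM N‖ + 1 with hL
  have hL0 : 0 < L := by positivity
  have hcabs : 0 < |c| := abs_pos.2 hc0
  -- After taking traces (factor at most `L`) and integrating over length `n T`, this tolerance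
  -- yields an error of at most `|ε * c| / 2`, half the main term.
  obtain ⟨ε₁, hε₁, hE⟩ := exists_norm_fderiv_sub_linearizationA_le hD hδ hf₀ hf₁' hS hS0
    (fun ε hε => (hx ε hε).1) hx₁0 hx₁ b
    (show 0 < |c| / (2 * ((n : ℝ) * T)) / L by positivity)
  refine ⟨ε₁, hε₁, fun ε hε hε0 hεlt hpos => ?_⟩
  have hεc : 0 < ε * c := by
    rw [hmean] at hpos
    exact pos_of_mul_pos_right hpos (by positivity)
  obtain ⟨hsol, hxper⟩ := hx ε hε
  have hF : ContDiffOn ℝ 1 (fun q : EuclideanSpace ℝ (Fin N) × ℝ => perturbedField f₀ f₁ ε q.2 q.1)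
      (D ×ˢ univ) := by
    refine (hf₀'.comp contDiffOn_fst fun _ hq => hq.1).add (ContDiffOn.const_smul ε ?_)
    exact hf₁'.comp (f := fun q : EuclideanSpace ℝ (Fin N) × ℝ => (q.1, q.2, ε))
      (contDiffOn_fst.prodMk (contDiffOn_snd.prodMk contDiffOn_const))
      fun q hq => ⟨hq.1, mem_univ _, hS hε⟩
  have hFper : ∀ z ∈ D, ∀ t, perturbedField f₀ f₁ ε (t + (n : ℝ) * T) z =
      perturbedField f₀ f₁ ε t z := by
    intro z hz t
    have h1 : Function.Periodic (fun t => f₁ z t ε) T := fun t => hper z hz t ε (hS hε)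
    simp only [perturbedField]
    have h2 : f₁ z (t + (n : ℝ) * T) ε = f₁ z t ε := h1.nat_mul n t
    rw [h2]
  have hxc : Continuous (x ε) := continuous_iff_continuousAt.2 fun t => (hsol t).2.continuousAt
  have hBc : Continuous fun t => traceCLM N (fderiv ℝ (perturbedField f₀ f₁ ε t) (x ε t)) :=
    (traceCLM N).continuous.comp <| continuousOn_univ.1 <|
      (continuousOn_fderiv_slice hD hF).comp (f := fun t => (x ε t, t)) (by fun_prop)
        fun t _ => ⟨(hsol t).1, mem_univ _⟩
  refine isUnstable_of_integral_trace_pos hD hF hnT hFper hsol hxper ?_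
  have hAc : Continuous fun t => g₀ t + ε * g₁ t := hg₀c.add (hg₁c.const_mul ε)
  have hdiff : ‖∫ t in t₀..b, (traceCLM N (fderiv ℝ (perturbedField f₀ f₁ ε t) (x ε t)) -
      (g₀ t + ε * g₁ t))‖ ≤ |c| / (2 * ((n : ℝ) * T)) * |ε| * |b - t₀| := by
    refine intervalIntegral.norm_integral_le_of_norm_le_const fun t ht => ?_
    rw [uIoc_of_le hab] at ht
    rw [← htrA, ← map_sub]
    calc _ ≤ ‖traceCLM N‖ * (|c| / (2 * ((n : ℝ) * T)) / L * |ε|) :=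
          (traceCLM N).le_opNorm_of_le (hE ε hε hεlt t ⟨ht.1.le, ht.2⟩)
      _ ≤ L * (|c| / (2 * ((n : ℝ) * T)) / L * |ε|) := by gcongr; rw [hL]; linarith
      _ = _ := by field_simp
  rw [intervalIntegral.integral_sub (hBc.intervalIntegrable _ _) (hAc.intervalIntegrable _ _),
    hAint, Real.norm_eq_abs] at hdiff
  have e1 : |c| / (2 * ((n : ℝ) * T)) * |ε| * |b - t₀| = ε * c / 2 := by
    rw [hb, add_sub_cancel_left, abs_of_pos hnT, ← abs_of_pos hεc, abs_mul]
    field_simp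
  rw [e1] at hdiff
  linarith [(abs_le.1 hdiff).1]
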